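/- Let $X$ be a non-compact proper metric space (closed balls are compact). Then $X$ is coarsely equivalent to $\mathbb{Z}$ if and only if both of the following hold: (i) $X$ is coarsely geodesic and has coarse bounded geometry; (ii) the Higson corona $\nu X$ is homeomorphic to a topological sum $K_1\oplus K_2$ of two indecomposable continua, each of which is homeomorphic to $\nu\mathbb{N}$. Here $\mathbb{Z}$ and $\mathbb{N}$ carry the metric $|x-y|$, and the terms are as follows. A (not necessarily continuous) map $f:X\to Y$ of metric spaces is *coarse* if there is a non-decreasing $\sigma:[0,\infty)\to[0,\infty)$ with $d_Y(f(x),f(y))\le\sigma(d_X(x,y))$ for all $x,y\in X$, and $f^{-1}(B)$ is bounded for every bounded $B\subset Y$. The spaces $X,Y$ are *coarsely equivalent* if there are coarse maps $f:X\to Y$ and $g:Y\to X$ such that $d_X(g(f(x)),x)$ and $d_Y(f(g(y)),y)$ are bounded uniformly in $x\in X$ and in $y\in Y$, respectively. A metric space is *geodesic* if any two points $x,y$ are the endpoints of an isometric copy of the interval $[0,d(x,y)]$; $X$ is *coarsely geodesic* if it is coarsely equivalent to a geodesic metric space. $X$ has *coarse bounded geometry* if there are a set $A\subset X$, a number $r>0$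 such that every point of $X$ is at distance less than $r$ from some point of $A$, and a function $\lambda:[0,\infty)\to[0,\infty)$ such that $\#(A\cap B(x,t))\le\lambda(t)$ for all $x\in X$ and $t>0$, where $B(x,t)$ is the closed ball. For a proper metric space $X$, let $C_H(X)$ be the set of bounded continuous functions $f:X\to\mathbb{R}$ such that for all $r,\varepsilon>0$ there is a compact $K\subset X$ with $\operatorname{diam} f(B(x,r))<\varepsilon$ for all $x\in X\setminus K$. The *Higson compactification* $X^\nu$ is the closure of the image of $X$ under the embedding $x\mapsto (f(x))_f$ into $\prod_{f\in C_H(X)}[\inf f,\sup f]$, and the *Higson corona* is $\nu X=X^\nu\setminus X$, where $X$ is identified with its image. A *continuum* is a non-empty compact connected Hausdorff space. It is *indecomposable* if it is not the union of two subcontinua (subspaces that are continua), each different from the whole space. -/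

import Mathlib

open scoped NNReal BoundedContinuousFunction

universe u v

namespace CoarseCorona

section CoarseMaps

variable {X : Type u} {Y : Type v} [MetricSpace X] [MetricSpace Y]

/-- `d(f x, f y) ≤ σ (d(x, y))` for some non-decreasing `σ : ℝ₊ → ℝ₊`. -/
def UniformlyExpansive (f : X → Y) : Prop :=
  ∃ σ : ℝ≥0 → ℝ≥0, Monotone σ ∧ ∀ x y : X, nndist (f x) (f y) ≤ σ (nndist x y)

/-- Preimages of bounded sets are bounded. -/
def MetricallyProper (f : X → Y) : Prop :=
  ∀ B : Set Y, Bornology.IsBounded B → Bornology.IsBounded (f ⁻¹' B)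

/-- Coarse maps; no continuity is required. -/
structure IsCoarseMap (f : X → Y) : Prop where
  uniformlyExpansive : UniformlyExpansive f
  metricallyProper : MetricallyProper f

/-- Two maps are close if they are at bounded distance from each other. -/
def AreClose (f g : X → Y) : Prop :=
  ∃ r : ℝ, 0 < r ∧ ∀ x : X, dist (f x) (g x) < r

/-- A coarse map with a coarse inverse up to closeness. -/
def IsCoarseEquivalence (f : X → Y) : Prop :=
  IsCoarseMap f ∧ ∃ g : Y → X, IsCoarseMap g ∧ AreClose (g ∘ f) id ∧ AreClose (f ∘ g) id

end CoarseMaps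

/-- There is a coarse equivalence from `X` to `Y`. -/
def CoarselyEquivalent (X : Type u) (Y : Type v) [MetricSpace X] [MetricSpace Y] : Prop :=
  ∃ f : X → Y, IsCoarseEquivalence f

/-- Any two points `x`, `y` are joined by an isometric copy of the interval `[0, d(x, y)]`. -/
def IsGeodesicSpace (M : Type u) [MetricSpace M] : Prop :=
  ∀ x y : M, ∃ γ : ℝ → M, γ 0 = x ∧ γ (dist x y) = y ∧
    ∀ s ∈ Set.Icc (0 : ℝ) (dist x y), ∀ t ∈ Set.Icc (0 : ℝ) (dist x y),
      dist (γ s) (γ t) = |s - t|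

/-- Coarsely equivalent to a geodesic metric space. Taking the geodesic space in the universe of
`X` is no restriction: the graph realizing `X` with edges between points at distance at most a
suitable constant lives there. -/
def IsCoarselyGeodesic (X : Type u) [MetricSpace X] : Prop :=
  ∃ (M : Type u) (_ : MetricSpace M), IsGeodesicSpace M ∧ CoarselyEquivalent X M

/-- Every point of the space is within a fixed distance of `A`. -/
def IsNetIn {X : Type u} [MetricSpace X] (A : Set X) : Prop :=
  ∃ r : ℝ, 0 < r ∧ ∀ x : X, ∃ a ∈ A, dist x a < r

/-- There is a net whose intersections with closed balls are finite, of cardinality bounded in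
terms of the radius alone. -/
def HasCoarseBoundedGeometry (X : Type u) [MetricSpace X] : Prop :=
  ∃ A : Set X, IsNetIn A ∧ ∃ L : ℝ≥0 → ℝ≥0, ∀ (x : X) (t : ℝ≥0), 0 < t →
    (A ∩ Metric.closedBall x t).Finite ∧ ((A ∩ Metric.closedBall x t).ncard : ℝ≥0) ≤ L t

section Higson

variable (X : Type u) [MetricSpace X]

/-- The bounded continuous real functions `f` such that, for each `r > 0`, the diameter of
`f (B(x, r))` tends to `0` as `x` leaves the compact sets. As `f` is bounded, all these diameters
are genuine finite suprema. -/
def HigsonFunctions : Set (X →ᵇ ℝ) :=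
  {f | ∀ r : ℝ, 0 < r → ∀ ε : ℝ, 0 < ε → ∃ K : Set X, IsCompact K ∧
    ∀ x ∉ K, Metric.diam (f '' Metric.closedBall x r) < ε}

/-- The product, over all Higson functions `f`, of the intervals `[inf f, sup f]`. -/
abbrev HigsonCube : Type u :=
  (f : HigsonFunctions X) → Set.Icc (⨅ x, f.1 x) (⨆ x, f.1 x)

/-- The evaluation map `x ↦ (f x)_f`. -/
def higsonEval (x : X) : HigsonCube X := fun f =>
  ⟨f.1 x, ciInf_le (BoundedContinuousFunction.isBounded_range f.1).bddBelow x,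
    le_ciSup (BoundedContinuousFunction.isBounded_range f.1).bddAbove x⟩

/-- The closure of the image of `X` in the cube. -/
def higsonCompactification : Set (HigsonCube X) := closure (Set.range (higsonEval X))

/-- The Higson corona `νX`: the Higson compactification minus (the image of) `X`, with the
subspace topology. -/
abbrev HigsonCorona : Type u :=
  ↥(higsonCompactification X \ Set.range (higsonEval X))

end Higson

/-- A continuum: a non-empty, compact, connected Hausdorff space. -/
def IsContinuum (K : Type u) [TopologicalSpace K] : Prop :=
  Nonempty K ∧ CompactSpace K ∧ PreconnectedSpace K ∧ T2Space K

/-- `K` is the union of two proper subcontinua. -/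
def IsDecomposable (K : Type u) [TopologicalSpace K] : Prop :=
  ∃ C D : Set K, IsContinuum C ∧ IsContinuum D ∧
    C ≠ Set.univ ∧ D ≠ Set.univ ∧ C ∪ D = Set.univ

/-- A continuum that is not decomposable. -/
def IsIndecomposableContinuum (K : Type u) [TopologicalSpace K] : Prop :=
  IsContinuum K ∧ ¬ IsDecomposable K

/-- `T` is homeomorphic to a disjoint sum of two indecomposable continua, each homeomorphic to
`S`. The summands may be taken in the universe of `S`, since they are homeomorphic to `S`. -/
def IsSumOfTwoIndecomposableContinuaHomeomorphicTo (T : Type u) (S : Type v)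
    [TopologicalSpace T] [TopologicalSpace S] : Prop :=
  ∃ (K₁ K₂ : Type v) (_ : TopologicalSpace K₁) (_ : TopologicalSpace K₂),
    IsIndecomposableContinuum K₁ ∧ IsIndecomposableContinuum K₂ ∧
    Nonempty (K₁ ≃ₜ S) ∧ Nonempty (K₂ ≃ₜ S) ∧ Nonempty (T ≃ₜ K₁ ⊕ K₂)

end CoarseCorona

/-! The corona is a quotient of the space of ultrafilters that contain no bounded set, and two of
them have the same limit exactly when no member of one diverges from a member of the other
(`coronaLim_eq_iff`). So every `A ⊆ X` has a closed trace on the corona, divergence means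
disjointness of traces (`diverge_iff_disjoint_trace`), and traces separate closed sets from each
other (`exists_trace_between`). This turns topology of the corona into coarse geometry of `X`.

From `ℤ` to the corona: the two half-lines diverge and each is a copy of `ℕ`, so functoriality
yields two copies of the corona of `ℕ`. That corona is connected because no tail of `ℕ` splits into
two diverging unbounded parts. It is indecomposable: suppose a proper subcontinuum contains the
trace of an unbounded `Q`. Points of some unbounded `P` far from the subcontinuum interleave with
points of `Q`. Cutting at them and sorting the blocks by parity disconnects the subcontinuum
(`isBounded_of_trace_subset_nat`).

From the corona to `ℤ`: a coarsely geodesic space carries a graph whose path metric is coarsely the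
given one. The two summands are the traces of some `P` and `Pᶜ`, which diverge. Limits of graph
geodesics give a coarse ray in each part. If `P` contained points arbitrarily far from its ray, one
could attach to the ray distant connected hairs, each containing a large ball
(`IsCoarseRay.exists_hairs`). The ray with every second hair has a connected trace with interior,
which misses the limits of the centres of the other balls. Proper subcontinua of an indecomposable
continuum have no interior (`IsIndecomposableContinuum.eq_univ`), so this is impossible. Hence `X`
lies near two diverging rays from a common origin, which form a coarse line
(`coarselyEquivalent_int_of_rays`). -/

namespace CoarseCorona

open Filter Topology Bornology Metric Set

/-! ### Diverging subsets of a metric space. -/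

section Divergence

variable {X : Type u} [MetricSpace X]

/-- Two sets diverge if neighbourhoods of them of any given radius meet in a bounded set. -/
def Diverge (A B : Set X) : Prop :=
  ∀ r : ℝ, IsBounded {x | x ∈ A ∧ ∃ y ∈ B, dist x y ≤ r}

theorem Diverge.mono {A B A' B' : Set X} (h : Diverge A B) (hA : A' ⊆ A) (hB : B' ⊆ B) :
    Diverge A' B' := fun r =>
  (h r).subset fun _ ⟨hx, y, hy, hxy⟩ => ⟨hA hx, y, hB hy, hxy⟩

theorem Diverge.symm {A B : Set X} (h : Diverge A B) : Diverge B A := by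
  intro r
  refine ((h r).cthickening (δ := r)).subset ?_
  rintro x ⟨hx, y, hy, hxy⟩
  exact mem_cthickening_of_dist_le x y r _ ⟨hy, x, hx, by rwa [dist_comm]⟩ hxy

/-- To diverge, it suffices that points of `A` and `B` at distance at most `r` are near `o`. -/
theorem diverge_of_dist_le {A B : Set X} (o : X)
    (h : ∀ r : ℝ, ∃ R : ℝ, ∀ x ∈ A, ∀ y ∈ B, dist x y ≤ r → dist x o ≤ R) : Diverge A B := by
  intro r
  obtain ⟨R, hR⟩ := h r
  exact (isBounded_closedBall (x := o) (r := R)).subset fun x ⟨hx, y, hy, hxy⟩ => hR x hx y hy hxy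

theorem Diverge.exists_dist_le {A B : Set X} (h : Diverge A B) (o : X) (r : ℝ) :
    ∃ R : ℝ, ∀ x ∈ A, ∀ y ∈ B, dist x y ≤ r → dist x o ≤ R := by
  obtain ⟨R, hR⟩ := (h r).subset_closedBall o
  exact ⟨R, fun x hx y hy hxy => hR ⟨hx, y, hy, hxy⟩⟩

theorem Diverge.isBounded_infDist {A B : Set X} (h : Diverge A B) (hA : A.Nonempty)
    (hB : B.Nonempty) (R : ℝ) : IsBounded {x | infDist x A < R ∧ infDist x B < R} := by
  refine ((h (2 * R)).cthickening (δ := R)).subset ?_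
  rintro x ⟨hxA, hxB⟩
  obtain ⟨a, ha, hxa⟩ := (infDist_lt_iff hA).1 hxA
  obtain ⟨b, hb, hxb⟩ := (infDist_lt_iff hB).1 hxB
  refine mem_cthickening_of_dist_le x a R _ ⟨ha, b, hb, ?_⟩ hxa.le
  have := dist_triangle_left a b x
  linarith

end Divergence

/-! ### Construction of Higson functions separating diverging sets. -/

section HigsonFunctions

variable {X : Type u} [MetricSpace X]

theorem mem_higsonFunctions [ProperSpace X] {f : X →ᵇ ℝ}
    (h : ∀ r : ℝ, 0 < r → ∀ ε : ℝ, 0 < ε → ∃ K : Set X, IsBounded K ∧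
      ∀ x ∉ K, ∀ y, dist x y ≤ r → |f x - f y| ≤ ε) : f ∈ HigsonFunctions X := by
  intro r hr ε hε
  obtain ⟨K, hK, h⟩ := h r hr (ε / 3) (by positivity)
  refine ⟨closure K, hK.isCompact_closure, fun x hx => ?_⟩
  have hx' := fun hxK => hx (subset_closure hxK)
  refine lt_of_le_of_lt (diam_le_of_forall_dist_le (C := 2 * (ε / 3)) (by positivity) ?_)
    (by linarith)
  rintro _ ⟨y, hy, rfl⟩ _ ⟨z, hz, rfl⟩
  have h1 := h x hx' y (by rw [dist_comm]; exact hy)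
  have h2 := h x hx' z (by rw [dist_comm]; exact hz)
  rw [Real.dist_eq]
  rw [abs_le] at *
  constructor <;> linarith [h1.1, h1.2, h2.1, h2.2]

theorem exists_isBounded_of_mem_higsonFunctions {f : X →ᵇ ℝ} (hf : f ∈ HigsonFunctions X)
    (r : ℝ) {ε : ℝ} (hε : 0 < ε) :
    ∃ K : Set X, IsBounded K ∧ ∀ x ∉ K, ∀ y, dist x y ≤ r → |f x - f y| < ε := by
  obtain ⟨K, hK, h⟩ := hf (max r 1) (by positivity) ε hε
  refine ⟨K, hK.isBounded, fun x hx y hxy => lt_of_le_of_lt ?_ (h x hx)⟩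
  rw [← Real.dist_eq]
  refine dist_le_diam_of_mem (f.isBounded_range.subset (image_subset_range _ _))
    ⟨x, mem_closedBall_self (by positivity), rfl⟩ ⟨y, ?_, rfl⟩
  rw [mem_closedBall, dist_comm]
  exact hxy.trans (le_max_left _ _)

/-- With `a`, `b` the distances to two diverging sets, this bounds the oscillation of `a / (a + b +
1)`. The bound is small where `a + b` is large, that is, off a bounded set. -/
theorem abs_div_sub_div_le {a b a' b' r : ℝ} (ha : 0 ≤ a) (hb : 0 ≤ b) (ha' : 0 ≤ a')
    (hb' : 0 ≤ b') (h1 : |a - a'| ≤ r) (h2 : |b - b'| ≤ r) :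
    |a / (a + b + 1) - a' / (a' + b' + 1)| ≤ r / (a + b + 1) := by
  have hs : 0 < a + b + 1 := by linarith
  have hs' : 0 < a' + b' + 1 := by linarith
  have key : a / (a + b + 1) - a' / (a' + b' + 1) =
      ((a - a') * (b' + 1) + a' * (b' - b)) / ((a + b + 1) * (a' + b' + 1)) := by
    field_simp
    ring
  rw [key, abs_div, abs_of_pos (mul_pos hs hs'), div_le_div_iff₀ (mul_pos hs hs') hs]
  have : |(a - a') * (b' + 1) + a' * (b' - b)| ≤ r * (a' + b' + 1) := by
    refine (abs_add_le _ _).trans ?_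
    rw [abs_mul, abs_mul, abs_of_nonneg ha', abs_of_pos (show 0 < b' + 1 by linarith),
      abs_sub_comm b' b]
    nlinarith [mul_le_mul_of_nonneg_right h1 (show 0 ≤ b' + 1 by linarith),
      mul_le_mul_of_nonneg_left h2 ha']
  calc _ ≤ r * (a' + b' + 1) * (a + b + 1) := by gcongr
    _ = _ := by ring

/-- A Higson function that vanishes on `A` and is at least `1 / 2` on the distant part of `B`. -/
theorem Diverge.exists_higsonFunction [ProperSpace X] {A B : Set X} (h : Diverge A B)
    (hA : A.Nonempty) (hB : B.Nonempty) :
    ∃ f ∈ HigsonFunctions X, (∀ x ∈ A, f x = 0) ∧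
      ∃ K : Set X, IsBounded K ∧ ∀ x ∈ B, x ∉ K → 1 / 2 ≤ f x := by
  have hs : ∀ x, 0 < infDist x A + infDist x B + 1 := fun x => by
    linarith [infDist_nonneg (x := x) (s := A), infDist_nonneg (x := x) (s := B)]
  have h01 : ∀ x, infDist x A / (infDist x A + infDist x B + 1) ∈ Icc (0 : ℝ) 1 := fun x =>
    ⟨div_nonneg infDist_nonneg (hs x).le, (div_le_one (hs x)).2 (by
      linarith [infDist_nonneg (x := x) (s := B)])⟩
  let f : X →ᵇ ℝ := BoundedContinuousFunction.ofNormedAddCommGroup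
    (fun x => infDist x A / (infDist x A + infDist x B + 1))
    ((continuous_infDist_pt A).div
      (((continuous_infDist_pt A).add (continuous_infDist_pt B)).add continuous_const)
      fun x => (hs x).ne') 1
    fun x => by rw [Real.norm_eq_abs, abs_of_nonneg (h01 x).1]; exact (h01 x).2
  have hf : ∀ x, f x = infDist x A / (infDist x A + infDist x B + 1) := fun _ => rfl
  have hlip : ∀ (S : Set X) (x y : X), |infDist x S - infDist y S| ≤ dist x y := fun S x y => by
    simpa [Real.dist_eq] using (lipschitz_infDist_pt S).dist_le_mul x y
  -- Off the first bounded set one of the distances is at least `r / ε`, so the oscillation `r / (a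
  -- + b + 1)` is at most `ε`. On `B` one has `b = 0`, and `a / (a + 1) ≥ 1 / 2` as soon as `a ≥ 1`.
  refine ⟨f, mem_higsonFunctions fun r hr ε hε => ⟨_, h.isBounded_infDist hA hB (r / ε), ?_⟩,
    fun x hx => by rw [hf, infDist_zero_of_mem hx, zero_div], _, h.isBounded_infDist hA hB 1, ?_⟩
  · intro x hx y hxy
    rw [hf, hf]
    refine (abs_div_sub_div_le infDist_nonneg infDist_nonneg infDist_nonneg infDist_nonneg
      ((hlip A x y).trans hxy) ((hlip B x y).trans hxy)).trans ?_
    rw [div_le_iff₀ (hs x), mul_comm, ← div_le_iff₀ hε]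
    have h1 := infDist_nonneg (x := x) (s := A)
    have h2 := infDist_nonneg (x := x) (s := B)
    simp only [mem_ofPred_eq, not_and_or, not_lt] at hx
    rcases hx with hx | hx <;> linarith
  · intro x hx hxK
    rw [hf]
    simp only [mem_ofPred_eq, not_and_or, not_lt, infDist_zero_of_mem hx] at hxK ⊢
    rw [div_le_div_iff₀ (by norm_num) (by linarith [infDist_nonneg (x := x) (s := A)])]
    rcases hxK with hxK | hxK <;> linarith

end HigsonFunctions

/-! ### The compact space of ultrafilters at infinity. -/

section UltrafiltersAtInfinity

/-- The ultrafilters on a metric space that contain no bounded set. -/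
abbrev UltrafilterAtInfty (X : Type u) [MetricSpace X] : Type u :=
  {U : Ultrafilter X // (U : Filter X) ≤ cobounded X}

variable {X : Type u} [MetricSpace X]

instance : CompactSpace (UltrafilterAtInfty X) := by
  refine isCompact_iff_compactSpace.1 (IsClosed.isCompact ?_)
  have : {U : Ultrafilter X | (U : Filter X) ≤ cobounded X} =
      ⋂ s ∈ cobounded X, {U : Ultrafilter X | s ∈ U} := by
    ext U
    simp [Filter.le_def]
  change IsClosed {U : Ultrafilter X | (U : Filter X) ≤ cobounded X}
  rw [this]
  exact isClosed_biInter fun s _ => ultrafilter_isClosed_basic s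

theorem exists_ultrafilterAtInfty_mem {A : Set X} (hA : ¬ IsBounded A) :
    ∃ U : UltrafilterAtInfty X, A ∈ U.1 := by
  have : (cobounded X ⊓ 𝓟 A).NeBot := by
    rw [inf_principal_neBot_iff]
    intro s hs
    by_contra hne
    refine hA ((isBounded_def.2 (mem_of_superset hs fun x hx hxA => hne ⟨x, hx, hxA⟩)))
  refine ⟨⟨Ultrafilter.of (cobounded X ⊓ 𝓟 A), (Ultrafilter.of_le _).trans inf_le_left⟩, ?_⟩
  exact (Ultrafilter.of_le _) (mem_inf_of_right (mem_principal_self A))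

theorem UltrafilterAtInfty.not_isBounded (U : UltrafilterAtInfty X) {A : Set X} (hA : A ∈ U.1) :
    ¬ IsBounded A := fun h => U.1.compl_notMem_iff.2 hA (U.2 (isBounded_def.1 h))

theorem UltrafilterAtInfty.diff_mem (U : UltrafilterAtInfty X) {A K : Set X} (hA : A ∈ U.1)
    (hK : IsBounded K) : A \ K ∈ U.1 :=
  inter_mem hA (U.2 (isBounded_def.1 hK))

theorem isClosed_setOf_mem_ultrafilterAtInfty (A : Set X) :
    IsClosed {U : UltrafilterAtInfty X | A ∈ U.1} :=
  (ultrafilter_isClosed_basic A).preimage continuous_subtype_val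

end UltrafiltersAtInfinity

/-! ### The corona as a quotient of the ultrafilters at infinity. -/

section Corona

variable {X : Type u} [MetricSpace X]

theorem tendsto_higsonEval (U : Ultrafilter X) :
    Tendsto (higsonEval X) U (𝓝 (Ultrafilter.extend (higsonEval X) U)) :=
  ultrafilter_extend_eq_iff.1 rfl

theorem tendsto_higsonFunction (U : Ultrafilter X) (f : HigsonFunctions X) :
    Tendsto f.1 U (𝓝 (Ultrafilter.extend (higsonEval X) U f).1) :=
  (continuous_subtype_val.tendsto _).comp
    (((continuous_apply f).tendsto _).comp (tendsto_higsonEval U))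

theorem continuous_higsonEval : Continuous (higsonEval X) :=
  continuous_pi fun f => f.1.continuous.subtype_mk _

/-- The limit of an ultrafilter at infinity is not the evaluation at any point. -/
theorem extend_notMem_range [ProperSpace X] (U : UltrafilterAtInfty X) :
    Ultrafilter.extend (higsonEval X) U.1 ∉ range (higsonEval X) := by
  rintro ⟨x, hx⟩
  have hdiv : Diverge {x} ({x}ᶜ : Set X) := fun r => isBounded_singleton.subset fun y hy => hy.1
  have hU : ({x}ᶜ : Set X) ∈ U.1 := U.2 (isBounded_def.1 isBounded_singleton)
  obtain ⟨f, hf, hfx, K, hK, hfK⟩ := hdiv.exists_higsonFunction (singleton_nonempty x)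
    (Ultrafilter.nonempty_of_mem hU)
  have h1 : (1 / 2 : ℝ) ≤ (Ultrafilter.extend (higsonEval X) U.1 ⟨f, hf⟩).1 :=
    ge_of_tendsto (tendsto_higsonFunction U.1 ⟨f, hf⟩)
      (mem_of_superset (U.diff_mem hU hK) fun y hy => hfK y hy.1 hy.2)
  rw [← hx] at h1
  have : (higsonEval X x ⟨f, hf⟩).1 = 0 := hfx x rfl
  norm_num [this] at h1

theorem extend_mem_higsonCompactification (U : Ultrafilter X) :
    Ultrafilter.extend (higsonEval X) U ∈ higsonCompactification X :=
  mem_closure_of_tendsto (tendsto_higsonEval U) (Eventually.of_forall fun x => ⟨x, rfl⟩)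

/-- The point of the corona to which an ultrafilter at infinity converges. -/
noncomputable def coronaLim [ProperSpace X] (U : UltrafilterAtInfty X) : HigsonCorona X :=
  ⟨Ultrafilter.extend (higsonEval X) U.1,
    extend_mem_higsonCompactification U.1, extend_notMem_range U⟩

theorem continuous_coronaLim [ProperSpace X] :
    Continuous (coronaLim : UltrafilterAtInfty X → HigsonCorona X) :=
  ((continuous_ultrafilter_extend _).comp continuous_subtype_val).subtype_mk _

/-- A corona point is a limit of an ultrafilter on the image of `X`, which is pulled back to `X`.
The pullback contains no bounded set: such a set has compact closure, so the ultrafilter would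
converge in `X` and the limit would lie in the image of `X`. -/
theorem surjective_coronaLim [ProperSpace X] :
    Function.Surjective (coronaLim : UltrafilterAtInfty X → HigsonCorona X) := by
  rintro ⟨p, hp, hpX⟩
  obtain ⟨G, hG, hGp⟩ := mem_closure_iff_ultrafilter.1 hp
  have hbot : (comap (higsonEval X) G).NeBot := by
    rw [comap_neBot_iff]
    intro t ht
    obtain ⟨_, hy, x, rfl⟩ := G.nonempty_of_mem (inter_mem ht hG)
    exact ⟨x, hy⟩
  let U := Ultrafilter.of (comap (higsonEval X) (G : Filter _))
  have hU : Tendsto (higsonEval X) U (𝓝 p) :=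
    ((map_mono (Ultrafilter.of_le _)).trans map_comap_le).trans hGp
  have hinf : (U : Filter X) ≤ cobounded X := by
    intro s hs
    by_contra hsU
    have hs' : IsBounded sᶜ := isBounded_compl_iff.2 hs
    have hsU' : closure sᶜ ∈ U :=
      mem_of_superset (Ultrafilter.compl_mem_iff_notMem.2 hsU) subset_closure
    obtain ⟨x, -, hx⟩ := hs'.isCompact_closure.ultrafilter_le_nhds U (le_principal_iff.2 hsU')
    exact hpX ⟨x, tendsto_nhds_unique
      ((continuous_higsonEval.tendsto x).mono_left hx) hU⟩
  exact ⟨⟨U, hinf⟩, Subtype.ext (ultrafilter_extend_eq_iff.2 hU)⟩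

instance [ProperSpace X] : CompactSpace (HigsonCorona X) :=
  ⟨by rw [← surjective_coronaLim.range_eq]; exact isCompact_range continuous_coronaLim⟩

theorem coronaLim_ne_of_diverge [ProperSpace X] {U V : UltrafilterAtInfty X} {A B : Set X}
    (hA : A ∈ U.1) (hB : B ∈ V.1) (h : Diverge A B) : coronaLim U ≠ coronaLim V := by
  intro heq
  obtain ⟨f, hf, hfA, K, hK, hfB⟩ := h.exists_higsonFunction
    (Ultrafilter.nonempty_of_mem hA) (Ultrafilter.nonempty_of_mem hB)
  have h0 : (Ultrafilter.extend (higsonEval X) U.1 ⟨f, hf⟩).1 ≤ 0 :=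
    le_of_tendsto (tendsto_higsonFunction U.1 ⟨f, hf⟩)
      (mem_of_superset hA fun y hy => (hfA y hy).le)
  have h1 : (1 / 2 : ℝ) ≤ (Ultrafilter.extend (higsonEval X) V.1 ⟨f, hf⟩).1 :=
    ge_of_tendsto (tendsto_higsonFunction V.1 ⟨f, hf⟩)
      (mem_of_superset (V.diff_mem hB hK) fun y hy => hfB y hy.1 hy.2)
  have : Ultrafilter.extend (higsonEval X) U.1 = Ultrafilter.extend (higsonEval X) V.1 :=
    congrArg Subtype.val heq
  rw [this] at h0
  linarith

/-- The sets `f < a` and `f > b`, for two levels `a < b` between the limits, diverge: far out, `f`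
varies by less than `b - a` on balls of a given radius. -/
theorem exists_diverge_of_lt {U V : UltrafilterAtInfty X} {f : HigsonFunctions X}
    (h : (Ultrafilter.extend (higsonEval X) U.1 f).1 <
      (Ultrafilter.extend (higsonEval X) V.1 f).1) :
    ∃ A ∈ U.1, ∃ B ∈ V.1, Diverge A B := by
  obtain ⟨a, ha1, ha2⟩ := exists_between h
  obtain ⟨b, hb1, hb2⟩ := exists_between ha2
  refine ⟨_, (tendsto_higsonFunction U.1 f).eventually (gt_mem_nhds ha1),
    _, (tendsto_higsonFunction V.1 f).eventually (lt_mem_nhds hb2), fun r => ?_⟩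
  obtain ⟨K, hK, hfK⟩ := exists_isBounded_of_mem_higsonFunctions f.2 r (sub_pos.2 hb1)
  refine hK.subset ?_
  rintro x ⟨hx, y, hy, hxy⟩
  by_contra hxK
  have := (abs_lt.1 (hfK x hxK y hxy)).1
  simp only [mem_ofPred_eq] at hx hy
  linarith

theorem coronaLim_eq_iff [ProperSpace X] {U V : UltrafilterAtInfty X} :
    coronaLim U = coronaLim V ↔ ∀ A ∈ U.1, ∀ B ∈ V.1, ¬ Diverge A B := by
  refine ⟨fun h A hA B hB hAB => coronaLim_ne_of_diverge hA hB hAB h, fun h => ?_⟩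
  refine Subtype.ext (funext fun f => Subtype.ext (le_antisymm ?_ ?_))
  · by_contra! hlt
    obtain ⟨A, hA, B, hB, hAB⟩ := exists_diverge_of_lt hlt
    exact h B hB A hA hAB.symm
  · by_contra! hlt
    obtain ⟨A, hA, B, hB, hAB⟩ := exists_diverge_of_lt hlt
    exact h A hA B hB hAB

/-- Maps that are close along an ultrafilter push it forward to the same corona point. -/
theorem coronaLim_eq_of_close {ι : Type v} [ProperSpace X] {V W : UltrafilterAtInfty X}
    {U : Ultrafilter ι} {f g : ι → X} (hf : V.1 = U.map f) (hg : W.1 = U.map g) {r : ℝ}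
    (h : ∀ᶠ x in U, dist (f x) (g x) ≤ r) : coronaLim V = coronaLim W := by
  refine coronaLim_eq_iff.2 fun A hA B hB hAB => V.not_isBounded ?_ (hAB r)
  rw [hf, Ultrafilter.mem_map] at hA ⊢
  rw [hg, Ultrafilter.mem_map] at hB
  filter_upwards [hA, hB, h] with x hxA hxB hx using ⟨hxA, g x, hxB, hx⟩

end Corona

/-! ### Traces of subsets on the corona: divergence, separation, connectedness. -/

section Trace

variable {X : Type u} [MetricSpace X] [ProperSpace X]

/-- The trace on the corona of the closure of `A` in the Higson compactification. -/
def trace (A : Set X) : Set (HigsonCorona X) :=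
  coronaLim '' {U : UltrafilterAtInfty X | A ∈ U.1}

theorem coronaLim_mem_trace {U : UltrafilterAtInfty X} {A : Set X} (h : A ∈ U.1) :
    coronaLim U ∈ trace A := ⟨U, h, rfl⟩

theorem isClosed_trace (A : Set X) : IsClosed (trace A) :=
  ((isClosed_setOf_mem_ultrafilterAtInfty A).isCompact.image continuous_coronaLim).isClosed

theorem trace_mono {A B : Set X} (h : A ⊆ B) : trace A ⊆ trace B :=
  image_mono fun _ hU => mem_of_superset hU h

theorem trace_union (A B : Set X) : trace (A ∪ B) = trace A ∪ trace B := by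
  rw [trace, trace, trace, ← image_union]
  congr 1
  ext U
  exact Ultrafilter.union_mem_iff

theorem trace_union_compl (A : Set X) : trace A ∪ trace Aᶜ = univ := by
  rw [← trace_union, union_compl_self]
  exact eq_univ_of_forall fun p => by
    obtain ⟨U, rfl⟩ := surjective_coronaLim p
    exact coronaLim_mem_trace univ_mem

theorem trace_nonempty {A : Set X} (h : ¬ IsBounded A) : (trace A).Nonempty := by
  obtain ⟨U, hU⟩ := exists_ultrafilterAtInfty_mem h
  exact ⟨_, coronaLim_mem_trace hU⟩

theorem trace_eq_empty {A : Set X} (h : IsBounded A) : trace A = ∅ :=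
  eq_empty_of_forall_notMem fun _ ⟨U, hU, _⟩ => U.not_isBounded hU h

theorem trace_subset_of_isBounded_diff {A B : Set X} (h : IsBounded (A \ B)) :
    trace A ⊆ trace B := by
  rintro _ ⟨U, hU, rfl⟩
  exact coronaLim_mem_trace (mem_of_superset (U.diff_mem hU h) fun x hx => by
    by_contra hB
    exact hx.2 ⟨hx.1, hB⟩)

theorem Diverge.disjoint_trace {A B : Set X} (h : Diverge A B) : Disjoint (trace A) (trace B) := by
  rw [disjoint_left]
  rintro _ ⟨U, hU, rfl⟩ ⟨V, hV, hUV⟩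
  exact coronaLim_ne_of_diverge hU hV h hUV.symm

theorem diverge_iff_disjoint_trace {A B : Set X} :
    Diverge A B ↔ Disjoint (trace A) (trace B) := by
  refine ⟨Diverge.disjoint_trace, fun h r => ?_⟩
  by_contra hb
  obtain ⟨U, hU⟩ := exists_ultrafilterAtInfty_mem hb
  -- `φ` moves points of `A` that are near `B` into `B`, by at most `r`. An ultrafilter at infinity
  -- on such points and its image under `φ` then have the same limit, which lies in both traces.
  have : ∀ x, ∃ y, x ∈ {x | x ∈ A ∧ ∃ y ∈ B, dist x y ≤ r} → y ∈ B ∧ dist x y ≤ r := fun x => by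
    by_cases hx : x ∈ {x | x ∈ A ∧ ∃ y ∈ B, dist x y ≤ r}
    · obtain ⟨-, y, hy⟩ := hx
      exact ⟨y, fun _ => hy⟩
    · exact ⟨x, fun h => absurd h hx⟩
  choose φ hφ using this
  have hφU : ((U.1.map φ : Ultrafilter X) : Filter X) ≤ cobounded X := by
    intro s hs
    have hb : IsBounded (cthickening r sᶜ) := (isBounded_compl_iff.2 hs).cthickening
    refine mem_map.2 ?_
    filter_upwards [U.diff_mem hU hb] with x hx
    by_contra hxs
    exact hx.2 (mem_cthickening_of_dist_le x (φ x) r _ hxs (hφ x hx.1).2)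
  have heq : coronaLim U = coronaLim ⟨U.1.map φ, hφU⟩ :=
    coronaLim_eq_of_close (U := U.1) (f := id) (g := φ) (by simp) rfl (r := r)
      (by filter_upwards [hU] with x hx using (hφ x hx).2)
  refine disjoint_left.1 h (coronaLim_mem_trace (mem_of_superset hU fun x hx => hx.1)) ?_
  rw [heq]
  exact coronaLim_mem_trace (mem_map.2 (by
    filter_upwards [hU] with x hx using (hφ x hx).1))

/-- Traces separate closed sets of the corona. -/
theorem exists_trace_between {C O : Set (HigsonCorona X)} (hC : IsClosed C) (hO : IsOpen O)
    (h : C ⊆ O) : ∃ A : Set X, Disjoint C (trace Aᶜ) ∧ trace A ⊆ O := by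
  -- The preimage of `C` is compact, and the sets of ultrafilters containing a given `A` form a
  -- basis that is stable under finite unions.
  have key : ∃ A : Set X, coronaLim ⁻¹' C ⊆ {U : UltrafilterAtInfty X | A ∈ U.1} ∧
      {U : UltrafilterAtInfty X | A ∈ U.1} ⊆ coronaLim ⁻¹' O := by
    refine (hC.preimage continuous_coronaLim).isCompact.induction_on
      (p := fun S => ∃ A : Set X, S ⊆ {U : UltrafilterAtInfty X | A ∈ U.1} ∧
        {U : UltrafilterAtInfty X | A ∈ U.1} ⊆ coronaLim ⁻¹' O) ?_ ?_ ?_ ?_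
    · exact ⟨∅, empty_subset _, fun U hU => absurd hU U.1.empty_notMem⟩
    · rintro S T hST ⟨A, hA⟩
      exact ⟨A, hST.trans hA.1, hA.2⟩
    · rintro S T ⟨A, hA⟩ ⟨B, hB⟩
      refine ⟨A ∪ B, ?_, ?_⟩
      · rintro U (hU | hU)
        · exact mem_of_superset (hA.1 hU) subset_union_left
        · exact mem_of_superset (hB.1 hU) subset_union_right
      · intro U hU
        rcases Ultrafilter.union_mem_iff.1 hU with hU | hU
        · exact hA.2 hU
        · exact hB.2 hU
    · intro U hU
      have hnhds : coronaLim ⁻¹' O ∈ 𝓝 U :=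
        (hO.preimage continuous_coronaLim).mem_nhds (h hU)
      rw [nhds_subtype_eq_comap, mem_comap] at hnhds
      obtain ⟨t, ht, htO⟩ := hnhds
      obtain ⟨_, ⟨A, rfl⟩, hAU, hAt⟩ := ultrafilterBasis_is_basis.mem_nhds_iff.1 ht
      refine ⟨{V : UltrafilterAtInfty X | A ∈ V.1}, mem_nhdsWithin_of_mem_nhds ?_, A,
        Subset.rfl, fun V hV => htO (hAt hV)⟩
      exact ((ultrafilter_isOpen_basic A).preimage continuous_subtype_val).mem_nhds hAU
  obtain ⟨A, hA1, hA2⟩ := key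
  refine ⟨A, disjoint_left.2 ?_, ?_⟩
  · rintro _ hU ⟨U, hU', rfl⟩
    exact U.1.compl_notMem_iff.2 (hA1 hU) hU'
  · rintro _ ⟨U, hU, rfl⟩
    exact hA2 hU

/-- A closed separation of the trace is induced, through `exists_trace_between`, by a partition of
`S`. Its two parts have disjoint traces and therefore diverge, so one of them is bounded and has
empty trace. -/
theorem isPreconnected_trace {S : Set X}
    (h : ∀ A B : Set X, A ∪ B = S → Diverge A B → IsBounded A ∨ IsBounded B) :
    IsPreconnected (trace S) := by
  rw [isPreconnected_iff_subset_of_disjoint_closed]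
  intro u v hu hv huv hdisj
  have hsub : trace S ∩ u ⊆ (trace S ∩ v)ᶜ := fun p hp hp' => by
    have : p ∈ trace S ∩ (u ∩ v) := ⟨hp.1, hp.2, hp'.2⟩
    rw [hdisj] at this
    exact this
  obtain ⟨P, hP1, hP2⟩ := exists_trace_between ((isClosed_trace S).inter hu)
    ((isClosed_trace S).inter hv).isOpen_compl hsub
  have hA : trace (S ∩ P) ⊆ u := fun p hp => by
    have hpS := trace_mono inter_subset_left hp
    rcases huv hpS with hpu | hpv
    · exact hpu
    · exact absurd ⟨hpS, hpv⟩ (hP2 (trace_mono inter_subset_right hp))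
  have hB : trace (S \ P) ⊆ v := fun p hp => by
    have hpS := trace_mono sdiff_subset hp
    rcases huv hpS with hpu | hpv
    · exact absurd (trace_mono (fun _ hx => hx.2) hp) (disjoint_left.1 hP1 ⟨hpS, hpu⟩)
    · exact hpv
  have hdiv : Diverge (S ∩ P) (S \ P) := by
    rw [diverge_iff_disjoint_trace, disjoint_left]
    intro p hp hp'
    have : p ∈ trace S ∩ (u ∩ v) := ⟨trace_mono inter_subset_left hp, hA hp, hB hp'⟩
    rw [hdisj] at this
    exact this
  have hS : trace S = trace (S ∩ P) ∪ trace (S \ P) := by rw [← trace_union, inter_union_sdiff]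
  rcases h _ _ (inter_union_sdiff S P) hdiv with hb | hb
  · right
    rw [hS, trace_eq_empty hb, empty_union]
    exact hB
  · left
    rw [hS, trace_eq_empty hb, union_empty]
    exact hA

end Trace

/-! ### Coarse maps and the maps of coronas that they induce. -/

section Functoriality

variable {X : Type u} {Y : Type v} [MetricSpace X] [MetricSpace Y]

theorem IsCoarseMap.tendsto_cobounded {f : X → Y} (hf : IsCoarseMap f) :
    Tendsto f (cobounded X) (cobounded Y) := fun s hs => by
  have := hf.metricallyProper sᶜ (isBounded_compl_iff.2 hs)
  rw [preimage_compl] at this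
  exact isBounded_compl_iff.1 this

theorem UniformlyExpansive.exists_dist_le {f : X → Y} (hf : UniformlyExpansive f) (r : ℝ) :
    ∃ s : ℝ, 0 ≤ s ∧ ∀ x y, dist x y ≤ r → dist (f x) (f y) ≤ s := by
  obtain ⟨σ, hσ, h⟩ := hf
  refine ⟨σ r.toNNReal, NNReal.coe_nonneg _, fun x y hxy => ?_⟩
  rw [← coe_nndist]
  exact NNReal.coe_le_coe.2 ((h x y).trans (hσ (NNReal.le_toNNReal_of_coe_le hxy)))

theorem uniformlyExpansive_of_exists_dist_le {f : X → Y}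
    (h : ∀ r : ℝ, ∃ s : ℝ, ∀ x y, dist x y ≤ r → dist (f x) (f y) ≤ s) :
    UniformlyExpansive f := by
  have hb : ∀ r : ℝ≥0, BddAbove {d | ∃ x y, nndist x y ≤ r ∧ d = nndist (f x) (f y)} := fun r => by
    obtain ⟨s, hs⟩ := h r
    refine ⟨s.toNNReal, ?_⟩
    rintro _ ⟨x, y, hxy, rfl⟩
    exact NNReal.le_toNNReal_of_coe_le (hs x y hxy)
  refine ⟨fun r => sSup {d | ∃ x y, nndist x y ≤ r ∧ d = nndist (f x) (f y)}, ?_, ?_⟩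
  · intro r s hrs
    rcases Set.eq_empty_or_nonempty {d | ∃ x y, nndist x y ≤ r ∧ d = nndist (f x) (f y)} with he | he
    · simp only [he, csSup_empty]
      exact bot_le
    · exact csSup_le_csSup (hb s) he fun d ⟨x, y, hxy, hd⟩ => ⟨x, y, hxy.trans hrs, hd⟩
  · exact fun x y => le_csSup (hb _) ⟨x, y, le_rfl, rfl⟩

theorem IsCoarseMap.isBounded_image {f : X → Y} (hf : IsCoarseMap f) {A : Set X}
    (hA : IsBounded A) : IsBounded (f '' A) := by
  rcases A.eq_empty_or_nonempty with rfl | ⟨a, -⟩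
  · simp
  obtain ⟨R, hR⟩ := hA.subset_closedBall a
  obtain ⟨s, -, hs⟩ := hf.uniformlyExpansive.exists_dist_le R
  refine (isBounded_closedBall (x := f a) (r := s)).subset ?_
  rintro _ ⟨x, hx, rfl⟩
  exact hs x a (hR hx)

theorem IsCoarseMap.comp {Z : Type*} [MetricSpace Z] {g : Y → Z} {f : X → Y} (hg : IsCoarseMap g)
    (hf : IsCoarseMap f) : IsCoarseMap (g ∘ f) := by
  refine ⟨?_, fun B hB => hf.metricallyProper _ (hg.metricallyProper B hB)⟩
  obtain ⟨σ, hσ, h⟩ := hf.uniformlyExpansive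
  obtain ⟨τ, hτ, h'⟩ := hg.uniformlyExpansive
  exact ⟨τ ∘ σ, hτ.comp hσ, fun x y => (h' _ _).trans (hτ (h x y))⟩

theorem Diverge.preimage {f : X → Y} (hf : IsCoarseMap f) {A B : Set Y} (h : Diverge A B) :
    Diverge (f ⁻¹' A) (f ⁻¹' B) := by
  intro r
  obtain ⟨s, -, hs⟩ := hf.uniformlyExpansive.exists_dist_le r
  exact (hf.metricallyProper _ (h s)).subset fun x ⟨hx, y, hy, hxy⟩ => ⟨hx, f y, hy, hs x y hxy⟩

/-- The push-forward of an ultrafilter at infinity under a coarse map. -/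
def UltrafilterAtInfty.map {f : X → Y} (hf : IsCoarseMap f) (U : UltrafilterAtInfty X) :
    UltrafilterAtInfty Y :=
  ⟨U.1.map f, hf.tendsto_cobounded.mono_left U.2⟩

theorem continuous_ultrafilterAtInfty_map {f : X → Y} (hf : IsCoarseMap f) :
    Continuous (UltrafilterAtInfty.map hf) := by
  have : Continuous fun U : Ultrafilter X => U.map f := by
    refine (ultrafilterBasis_is_basis (α := Y)).continuous_iff.2 ?_
    rintro _ ⟨s, rfl⟩
    exact ultrafilter_isOpen_basic (f ⁻¹' s)
  exact (this.comp continuous_subtype_val).subtype_mk _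

variable [ProperSpace X] [ProperSpace Y]

theorem coronaLim_map_eq {f : X → Y} (hf : IsCoarseMap f) {U V : UltrafilterAtInfty X}
    (h : coronaLim U = coronaLim V) : coronaLim (U.map hf) = coronaLim (V.map hf) :=
  coronaLim_eq_iff.2 fun _ hA _ hB hAB => coronaLim_eq_iff.1 h _ hA _ hB (hAB.preimage hf)

/-- A coarse map induces a continuous map of coronas. -/
theorem IsCoarseMap.exists_corona_map {f : X → Y} (hf : IsCoarseMap f) :
    ∃ F : HigsonCorona X → HigsonCorona Y, Continuous F ∧
      ∀ U, F (coronaLim U) = coronaLim (UltrafilterAtInfty.map hf U) := by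
  -- A continuous surjection from a compact space to a Hausdorff space is a quotient map, so the
  -- push-forward of ultrafilters descends.
  have hq : IsQuotientMap (coronaLim : UltrafilterAtInfty X → HigsonCorona X) :=
    IsQuotientMap.of_surjective_continuous surjective_coronaLim continuous_coronaLim
  let G : C(UltrafilterAtInfty X, HigsonCorona Y) :=
    ⟨_, continuous_coronaLim.comp (continuous_ultrafilterAtInfty_map hf)⟩
  refine ⟨hq.lift (f := ⟨_, continuous_coronaLim⟩) G fun U V h => coronaLim_map_eq hf h,
    ContinuousMap.continuous _, fun U => ?_⟩
  exact congrArg (fun φ : C(UltrafilterAtInfty X, HigsonCorona Y) => φ U)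
    (hq.lift_comp (f := ⟨_, continuous_coronaLim⟩) G fun U V h => coronaLim_map_eq hf h)

theorem coronaLim_eq_of_map_eq {f : X → Y} (hf : IsCoarseMap f)
    (hf' : ∀ r : ℝ, ∃ s : ℝ, ∀ x y, dist (f x) (f y) ≤ r → dist x y ≤ s)
    {U V : UltrafilterAtInfty X} (h : coronaLim (U.map hf) = coronaLim (V.map hf)) :
    coronaLim U = coronaLim V := by
  refine coronaLim_eq_iff.2 fun A hA B hB hAB => coronaLim_eq_iff.1 h (f '' A)
    (image_mem_map hA) (f '' B) (image_mem_map hB) fun r => ?_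
  obtain ⟨s, hs⟩ := hf' r
  refine (hf.isBounded_image (hAB s)).subset ?_
  rintro _ ⟨⟨x, hx, rfl⟩, _, ⟨y, hy, rfl⟩, hxy⟩
  exact ⟨x, ⟨hx, y, hy, hs x y hxy⟩, rfl⟩

end Functoriality

/-! ### Subcontinua of indecomposable continua. -/

section Continua

variable {K : Type u} [TopologicalSpace K]

/-- Adjoining to a connected `C` one part of a separation of the closure of `Cᶜ` gives a connected
set. -/
theorem isPreconnected_union_of_separation [PreconnectedSpace K] {C U V : Set K} (hC : IsClosed C)
    (hCc : IsPreconnected C) (hCne : C.Nonempty) (hU : IsClosed U) (hV : IsClosed V)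
    (hUV : Disjoint U V) (hcover : C ∪ U ∪ V = univ) : IsPreconnected (C ∪ U) := by
  have key : ∀ G H : Set K, IsClosed G → IsClosed H → C ∪ U ⊆ G ∪ H →
      (C ∪ U) ∩ (G ∩ H) = ∅ → C ⊆ G → C ∪ U ⊆ G := by
    intro G H hG hH hGH hdisj hCG
    -- Since `C` lies in `G`, the part in `H` lies in `U` and so misses the closed set `V`; its
    -- complement is thus closed too.
    have hclopen : IsClopen ((C ∪ U) ∩ H) := by
      refine ⟨(hC.union hU).inter hH, ?_⟩
      have : (C ∪ U) ∩ H = ((C ∪ U) ∩ G ∪ V)ᶜ := by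
        ext x
        have h1 : x ∈ C ∪ U ∪ V := hcover ▸ mem_univ x
        have h2 : x ∈ C ∪ U → x ∈ G ∪ H := fun hx => hGH hx
        have h3 : x ∉ (C ∪ U) ∩ (G ∩ H) := by simp [hdisj]
        have h4 : x ∈ U → x ∉ V := fun hx => disjoint_left.1 hUV hx
        have h5 : x ∈ C → x ∈ G := fun hx => hCG hx
        simp only [mem_union, mem_inter_iff, mem_compl_iff] at *
        tauto
      rw [this]
      exact (((hC.union hU).inter hG).union hV).isOpen_compl
    obtain ⟨c, hc⟩ := hCne
    rcases isClopen_iff.1 hclopen with h | h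
    · intro x hx
      rcases hGH hx with hxG | hxH
      · exact hxG
      · exact absurd (h ▸ ⟨hx, hxH⟩ : x ∈ (∅ : Set K)) (notMem_empty x)
    · have hcH : c ∈ (C ∪ U) ∩ H := h ▸ mem_univ c
      have : c ∈ (C ∪ U) ∩ (G ∩ H) := ⟨hcH.1, hCG hc, hcH.2⟩
      rw [hdisj] at this
      exact absurd this (notMem_empty c)
  rw [isPreconnected_iff_subset_of_disjoint_closed]
  intro G H hG hH hGH hdisj
  have hCdisj : C ∩ (G ∩ H) = ∅ :=
    subset_empty_iff.1 (hdisj ▸ inter_subset_inter_left _ subset_union_left)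
  rcases isPreconnected_iff_subset_of_disjoint_closed.1 hCc G H hG hH
    (subset_union_left.trans hGH) hCdisj with h | h
  · exact Or.inl (key G H hG hH hGH hdisj h)
  · exact Or.inr (key H G hH hG (union_comm G H ▸ hGH) (inter_comm G H ▸ hdisj) h)

theorem isContinuum_coe [CompactSpace K] [T2Space K] {C : Set K} (hC : IsClosed C)
    (hCc : IsPreconnected C) (hne : C.Nonempty) : IsContinuum C :=
  ⟨hne.to_subtype, isCompact_iff_compactSpace.1 hC.isCompact,
    isPreconnected_iff_preconnectedSpace.1 hCc, inferInstance⟩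

/-- A proper subcontinuum of an indecomposable continuum has empty interior. -/
theorem IsIndecomposableContinuum.eq_univ (hK : IsIndecomposableContinuum K) {C : Set K}
    (hC : IsClosed C) (hCc : IsPreconnected C) (hint : (interior C).Nonempty) : C = univ := by
  obtain ⟨⟨hne, hcomp, hconn, hT2⟩, hdec⟩ := hK
  have hCne : C.Nonempty := hint.mono interior_subset
  by_contra hCu
  refine hdec ?_
  have hWne : (closure Cᶜ).Nonempty := (nonempty_compl.2 hCu).mono subset_closure
  have hcov : C ∪ closure Cᶜ = univ :=
    univ_subset_iff.1 (union_compl_self C ▸ union_subset_union_right _ subset_closure)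
  -- If `closure Cᶜ` is connected, it and `C` decompose `K`. Otherwise each of the two parts of a
  -- separation of `closure Cᶜ` is adjoined to `C`.
  by_cases hW : IsPreconnected (closure Cᶜ)
  · refine ⟨C, closure Cᶜ, isContinuum_coe hC hCc hCne, isContinuum_coe isClosed_closure hW hWne,
      hCu, ?_, hcov⟩
    rw [closure_compl]
    intro h
    rw [compl_univ_iff] at h
    exact hint.ne_empty h
  · rw [isPreconnected_iff_subset_of_disjoint_closed] at hW
    push Not at hW
    obtain ⟨u, v, hu, hv, huv, hdisj, hWu, hWv⟩ := hW
    have hUcl := isClosed_closure (s := Cᶜ) |>.inter hu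
    have hVcl := isClosed_closure (s := Cᶜ) |>.inter hv
    have hUV : Disjoint (closure Cᶜ ∩ u) (closure Cᶜ ∩ v) := by
      rw [disjoint_left]
      intro x hx hx'
      have : x ∈ closure Cᶜ ∩ (u ∩ v) := ⟨hx.1, hx.2, hx'.2⟩
      rw [hdisj] at this
      exact this
    have hcover : C ∪ (closure Cᶜ ∩ u) ∪ (closure Cᶜ ∩ v) = univ := by
      rw [union_assoc, ← inter_union_distrib_left, inter_eq_left.2 huv, hcov]
    have hcover' : C ∪ (closure Cᶜ ∩ v) ∪ (closure Cᶜ ∩ u) = univ := by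
      rw [union_right_comm, hcover]
    have hne' : ∀ a b : Set K, IsClosed a → (closure Cᶜ ∩ (a ∩ b) = ∅) →
        (closure Cᶜ ⊆ a ∪ b) → ¬ closure Cᶜ ⊆ a → C ∪ (closure Cᶜ ∩ a) ≠ univ := by
      intro a b ha hab hcov' hWa h
      refine hWa (closure_minimal (fun x hx => ?_) ha)
      have : x ∈ C ∪ (closure Cᶜ ∩ a) := h ▸ mem_univ x
      exact (this.resolve_left hx).2
    refine ⟨C ∪ (closure Cᶜ ∩ u), C ∪ (closure Cᶜ ∩ v),
      isContinuum_coe (hC.union hUcl) (isPreconnected_union_of_separation hC hCc hCne hUcl hVcl hUV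
        hcover) (hCne.mono subset_union_left),
      isContinuum_coe (hC.union hVcl) (isPreconnected_union_of_separation hC hCc hCne hVcl hUcl
        hUV.symm hcover') (hCne.mono subset_union_left),
      hne' u v hu hdisj huv hWu, hne' v u hv (by rwa [inter_comm v u]) (by rwa [union_comm]) hWv, ?_⟩
    rw [← union_union_distrib_left, ← union_assoc, hcover]

end Continua

/-! ### The corona of `ℕ` is an indecomposable continuum. -/

section NaturalNumbers

theorem isBounded_of_forall_le {A : Set ℕ} (N : ℕ) (h : ∀ n ∈ A, n ≤ N) : IsBounded A :=
  ((finite_Iic N).subset h).isBounded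

theorem exists_mem_gt_of_not_isBounded {A : Set ℕ} (h : ¬ IsBounded A) (N : ℕ) :
    ∃ n ∈ A, N < n := by
  by_contra! hA
  exact h (isBounded_of_forall_le N hA)

theorem dist_le_dist_of_le_of_le {a b c : ℕ} (hab : a ≤ b) (hbc : b ≤ c) :
    dist a b ≤ dist a c := by
  rw [Nat.dist_eq, Nat.dist_eq, abs_sub_comm, abs_sub_comm (a : ℝ)]
  have h1 : (a : ℝ) ≤ b := by exact_mod_cast hab
  have h2 : (b : ℝ) ≤ c := by exact_mod_cast hbc
  rw [abs_of_nonneg (by linarith), abs_of_nonneg (by linarith)]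
  linarith

theorem preconnectedSpace_higsonCorona_nat : PreconnectedSpace (HigsonCorona ℕ) := by
  have huniv : trace (univ : Set ℕ) = univ := by
    rw [← trace_union_compl (univ : Set ℕ), ← trace_union]
    simp
  refine ⟨huniv ▸ isPreconnected_trace fun A B hAB hdiv => ?_⟩
  -- Beyond `N` consecutive integers lie on the same side, so the side of `N` contains the whole
  -- tail.
  have key : ∀ A B : Set ℕ, A ∪ B = univ → ∀ N : ℕ, N ∈ A →
      (∀ x ∈ A, ∀ y ∈ B, dist x y ≤ 1 → x < N) → IsBounded B := by
    intro A B hAB N hN hR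
    have htail : ∀ n, N ≤ n → n ∈ A := by
      intro n hn
      induction n, hn using Nat.le_induction with
      | base => exact hN
      | succ n hn ih =>
        have : n + 1 ∈ A ∪ B := hAB ▸ mem_univ _
        refine this.resolve_right fun hB => ?_
        exact absurd (hR n ih _ hB (by simp [Nat.dist_eq])) (by omega)
    refine isBounded_of_forall_le N fun n hn => ?_
    by_contra! hlt
    exact absurd (hR n (htail n hlt.le) n hn (by simp)) (by omega)
  obtain ⟨R, hR⟩ := hdiv.exists_dist_le 0 1
  obtain ⟨S, hS⟩ := hdiv.symm.exists_dist_le 0 1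
  obtain ⟨N, hN⟩ := exists_nat_gt (max R S)
  have h1 : ∀ x ∈ A, ∀ y ∈ B, dist x y ≤ 1 → x < N := fun x hx y hy hxy => by
    have := hR x hx y hy hxy
    simp only [Nat.dist_eq, Nat.cast_zero, sub_zero, Nat.abs_cast] at this
    exact_mod_cast this.trans_lt ((le_max_left R S).trans_lt hN)
  have h2 : ∀ x ∈ B, ∀ y ∈ A, dist x y ≤ 1 → x < N := fun x hx y hy hxy => by
    have := hS x hx y hy hxy
    simp only [Nat.dist_eq, Nat.cast_zero, sub_zero, Nat.abs_cast] at this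
    exact_mod_cast this.trans_lt ((le_max_right R S).trans_lt hN)
  have hNAB : N ∈ A ∪ B := hAB ▸ mem_univ _
  rcases hNAB with hN' | hN'
  · exact Or.inr (key A B hAB N hN' h1)
  · exact Or.inl (key B A (by rw [union_comm, hAB]) N hN' h2)

theorem isContinuum_higsonCorona_nat : IsContinuum (HigsonCorona ℕ) := by
  refine ⟨?_, inferInstance, preconnectedSpace_higsonCorona_nat, inferInstance⟩
  obtain ⟨p, -⟩ := trace_nonempty (A := (univ : Set ℕ)) fun h =>
    (exists_nat_gt (0 : ℝ)).elim fun _ _ => by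
      rw [isBounded_univ] at h
      exact not_compactSpace_iff.2 (inferInstance : NoncompactSpace ℕ)
        (isCompact_univ_iff.1 (isCompact_of_isClosed_isBounded isClosed_univ (isBounded_univ.2 h)))
  exact ⟨p⟩

/-- The blocks `[p k, p (k + 1))` with even and with odd index `k`, intersected with a set that
diverges from `{p k}`, diverge. -/
theorem diverge_blocks {E P : Set ℕ} (h : Diverge E P) {p : ℕ → ℕ} (hp : StrictMono p)
    (hpP : ∀ k, p k ∈ P) {S T : Set ℕ} (hST : Disjoint S T) :
    Diverge {x | x ∈ E ∧ ∃ k ∈ S, p k ≤ x ∧ x < p (k + 1)}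
      {x | x ∈ E ∧ ∃ k ∈ T, p k ≤ x ∧ x < p (k + 1)} := by
  refine diverge_of_dist_le 0 fun r => ?_
  obtain ⟨R, hR⟩ := h.exists_dist_le 0 r
  refine ⟨R, ?_⟩
  rintro x ⟨hxE, k, hk, hkx, hxk⟩ y ⟨-, j, hj, hjy, hyj⟩ hxy
  have hne : k ≠ j := fun hkj => disjoint_left.1 hST hk (hkj ▸ hj)
  rcases hne.lt_or_gt with hlt | hlt
  · have := hp.monotone (show k + 1 ≤ j from hlt)
    exact hR x hxE _ (hpP (k + 1)) ((dist_le_dist_of_le_of_le hxk.le (this.trans hjy)).trans hxy)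
  · have := hp.monotone (show j + 1 ≤ k from hlt)
    refine hR x hxE _ (hpP (j + 1)) (le_trans ?_ hxy)
    have hle := this.trans hkx
    rw [Nat.dist_eq, Nat.dist_eq]
    have h1 : ((p (j + 1) : ℕ) : ℝ) ≤ x := by exact_mod_cast hle
    have h2 : (y : ℝ) ≤ p (j + 1) := by exact_mod_cast hyj.le
    rw [abs_of_nonneg (by linarith), abs_of_nonneg (by linarith)]
    linarith

/-- A connected closed proper subset of the corona of `ℕ` contains no trace of an unbounded set. -/
theorem isBounded_of_trace_subset_nat {C : Set (HigsonCorona ℕ)} (hC : IsClosed C)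
    (hCc : IsPreconnected C) (hne : C ≠ univ) {Q : Set ℕ} (hQ : trace Q ⊆ C) : IsBounded Q := by
  by_contra hQb
  obtain ⟨z, hz⟩ := (ne_univ_iff_exists_notMem C).1 hne
  obtain ⟨P, hP1, hP2⟩ := exists_trace_between (isClosed_singleton (x := z)) hC.isOpen_compl
    (singleton_subset_iff.2 hz)
  have hPb : ¬ IsBounded P := fun hb => by
    have : z ∈ trace P ∪ trace Pᶜ := trace_union_compl P ▸ mem_univ z
    rw [trace_eq_empty hb, empty_union] at this
    exact disjoint_left.1 hP1 rfl this
  obtain ⟨E, hE1, hE2⟩ := exists_trace_between hC (isClosed_trace P).isOpen_compl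
    fun x hx hxP => hP2 hxP hx
  have hEP : Diverge E P := diverge_iff_disjoint_trace.2
    (disjoint_left.2 fun x hx hxP => hE2 hx hxP)
  have hQE : IsBounded (Q \ E) := by
    by_contra hb
    obtain ⟨x, hx⟩ := trace_nonempty hb
    exact disjoint_left.1 hE1 (hQ (trace_mono sdiff_subset hx))
      (trace_mono (fun y hy => hy.2) hx)
  choose a haP ha using exists_mem_gt_of_not_isBounded hPb
  choose b hbQ hb using exists_mem_gt_of_not_isBounded hQb
  -- The points `s (k + 1) ∈ Q` and `p k ∈ P` alternate: `p k < s (k + 1) < p (k + 1)`. Each block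
  -- `[p k, p (k + 1))` therefore contains a point of `Q`.
  let s : ℕ → ℕ := fun n => n.rec 0 fun _ m => b (a m)
  have hs : ∀ n, s (n + 1) = b (a (s n)) := fun _ => rfl
  let p : ℕ → ℕ := fun n => a (s n)
  have hps : ∀ k, p k < s (k + 1) := fun k => hb _
  have hsp : ∀ k, s k < p k := fun k => ha _
  have hp : StrictMono p := strictMono_nat_of_lt_succ fun k => (hps k).trans (hsp (k + 1))
  have hblock : ∀ x, p 0 ≤ x → ∃ k, p k ≤ x ∧ x < p (k + 1) := fun x hx => by
    by_contra! hcon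
    have : ∀ k, p k ≤ x := fun k => Nat.rec hx (fun k ih => hcon k ih) k
    exact absurd (this (x + 1)) (not_le.2 (Nat.lt_of_lt_of_le (Nat.lt_succ_self x) (hp.id_le _)))
  let F : Set ℕ → Set ℕ := fun S => {x | x ∈ E ∧ ∃ k ∈ S, p k ≤ x ∧ x < p (k + 1)}
  have hmeet : ∀ S : Set ℕ, (∀ N, ∃ k ∈ S, N ≤ k) → (C ∩ trace (F S)).Nonempty := by
    intro S hS
    have hub : ¬ IsBounded ((fun k => s (k + 1)) '' S) := fun hbd => by
      obtain ⟨R, hR⟩ := hbd.subset_closedBall 0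
      obtain ⟨N, hN⟩ := exists_nat_gt R
      obtain ⟨k, hk, hNk⟩ := hS N
      have h1 := hR ⟨k, hk, rfl⟩
      simp only [mem_closedBall, Nat.dist_eq, Nat.cast_zero, sub_zero, Nat.abs_cast] at h1
      have h2 : N ≤ s (k + 1) := hNk.trans ((hp.id_le k).trans (hps k).le)
      have h3 : (N : ℝ) ≤ s (k + 1) := by exact_mod_cast h2
      linarith
    have hsubQ : (fun k => s (k + 1)) '' S ⊆ Q := by
      rintro _ ⟨k, -, rfl⟩
      exact hbQ _
    obtain ⟨x, hx⟩ := trace_nonempty hub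
    refine ⟨x, hQ (trace_mono hsubQ hx), trace_subset_of_isBounded_diff (hQE.subset ?_) hx⟩
    rintro _ ⟨⟨k, hk, rfl⟩, hkF⟩
    exact ⟨hbQ _, fun hkE => hkF ⟨hkE, k, hk, (hps k).le, hsp (k + 1)⟩⟩
  have hcov : C ⊆ trace (F {k | Even k}) ∪ trace (F {k | ¬ Even k}) := by
    rw [← trace_union]
    intro x hx
    have hxE : x ∈ trace E := by
      have : x ∈ trace E ∪ trace Eᶜ := trace_union_compl E ▸ mem_univ x
      exact this.resolve_right (disjoint_left.1 hE1 hx)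
    refine trace_subset_of_isBounded_diff (isBounded_of_forall_le (p 0) ?_) hxE
    rintro n ⟨hnE, hnF⟩
    by_contra! hlt
    obtain ⟨k, hk⟩ := hblock n hlt.le
    by_cases hev : Even k
    · exact hnF (Or.inl ⟨hnE, k, hev, hk⟩)
    · exact hnF (Or.inr ⟨hnE, k, hev, hk⟩)
  -- The even and the odd blocks of `E` together cover `C`, and both meet it through points of `Q`.
  -- Connectedness gives a common point of the two traces, although these are disjoint by
  -- divergence.
  obtain ⟨x, -, hx, hx'⟩ := isPreconnected_closed_iff.1 hCc _ _ (isClosed_trace _)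
    (isClosed_trace _) hcov (hmeet _ fun N => ⟨2 * N, by simp, by omega⟩)
    (hmeet _ fun N => ⟨2 * N + 1, by simp, by omega⟩)
  have hparity : Disjoint {k : ℕ | Even k} {k | ¬ Even k} :=
    disjoint_left.2 fun k hk hk' => hk' hk
  exact disjoint_left.1 (diverge_blocks hEP hp (fun k => haP _) hparity).disjoint_trace hx hx'

/-- In a decomposition into `C` and `D`, the open complement of `D` contains the trace of an
unbounded set. That trace lies in the proper subcontinuum `C`. -/
theorem isIndecomposableContinuum_higsonCorona_nat :
    IsIndecomposableContinuum (HigsonCorona ℕ) := by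
  refine ⟨isContinuum_higsonCorona_nat, ?_⟩
  rintro ⟨C, D, hC, hD, hCu, hDu, hCD⟩
  have hCcl : IsClosed C := (isCompact_iff_compactSpace.2 hC.2.1).isClosed
  have hDcl : IsClosed D := (isCompact_iff_compactSpace.2 hD.2.1).isClosed
  obtain ⟨z, hz⟩ := (ne_univ_iff_exists_notMem D).1 hDu
  obtain ⟨Q, hQ1, hQ2⟩ := exists_trace_between (isClosed_singleton (x := z)) hDcl.isOpen_compl
    (singleton_subset_iff.2 hz)
  have hQC : trace Q ⊆ C := fun x hx => by
    have : x ∈ C ∪ D := hCD ▸ mem_univ x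
    exact this.resolve_right (hQ2 hx)
  have hQb := isBounded_of_trace_subset_nat hCcl (isPreconnected_iff_preconnectedSpace.2 hC.2.2.1)
    hCu hQC
  have : z ∈ trace Q ∪ trace Qᶜ := trace_union_compl Q ▸ mem_univ z
  rw [trace_eq_empty hQb, empty_union] at this
  exact disjoint_left.1 hQ1 rfl this

end NaturalNumbers

/-! ### Coarse embeddings and coarse equivalences. -/

section CoarseEquivalences

variable {X : Type u} {Y : Type v} [MetricSpace X] [MetricSpace Y]

theorem metricallyProper_of_exists_dist_le {L : Y → X}
    (h : ∀ r : ℝ, ∃ s : ℝ, ∀ x y, dist (L x) (L y) ≤ r → dist x y ≤ s) : MetricallyProper L := by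
  intro B hB
  rcases (L ⁻¹' B).eq_empty_or_nonempty with he | ⟨y, hy⟩
  · rw [he]
    exact isBounded_empty
  obtain ⟨R, hR⟩ := hB.subset_closedBall (L y)
  obtain ⟨s, hs⟩ := h R
  exact (isBounded_closedBall (x := y) (r := s)).subset fun x hx => hs x y (hR hx)

/-- A coarse embedding with coarsely dense image is a coarse equivalence. -/
theorem coarselyEquivalent_of_embedding {L : Y → X}
    (h1 : ∀ r : ℝ, ∃ s : ℝ, ∀ x y, dist x y ≤ r → dist (L x) (L y) ≤ s)
    (h2 : ∀ r : ℝ, ∃ s : ℝ, ∀ x y, dist (L x) (L y) ≤ r → dist x y ≤ s)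
    (h3 : ∃ s : ℝ, ∀ x, ∃ y, dist x (L y) ≤ s) : CoarselyEquivalent X Y := by
  obtain ⟨s, hs⟩ := h3
  choose f hf using hs
  have hfe : ∀ r : ℝ, ∃ t : ℝ, ∀ x y, dist x y ≤ r → dist (f x) (f y) ≤ t := fun r => by
    obtain ⟨t, ht⟩ := h2 (r + 2 * s)
    refine ⟨t, fun x y hxy => ht _ _ ?_⟩
    have e1 := dist_triangle4 (L (f x)) x y (L (f y))
    rw [dist_comm (L (f x)) x] at e1
    linarith [hf x, hf y]
  have hfp : ∀ r : ℝ, ∃ t : ℝ, ∀ x y, dist (f x) (f y) ≤ r → dist x y ≤ t := fun r => by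
    obtain ⟨t, ht⟩ := h1 r
    refine ⟨t + 2 * s, fun x y hxy => ?_⟩
    have e1 := dist_triangle4 x (L (f x)) (L (f y)) y
    rw [dist_comm (L (f y)) y] at e1
    linarith [hf x, hf y, ht _ _ hxy]
  refine ⟨f, ⟨uniformlyExpansive_of_exists_dist_le hfe, metricallyProper_of_exists_dist_le hfp⟩, L,
    ⟨uniformlyExpansive_of_exists_dist_le h1, metricallyProper_of_exists_dist_le h2⟩, ?_, ?_⟩
  · refine ⟨max s 0 + 1, by positivity, fun x => ?_⟩
    have := hf x
    rw [dist_comm] at this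
    exact this.trans_lt ((le_max_left s 0).trans_lt (lt_add_one _))
  · obtain ⟨t, ht⟩ := h2 s
    refine ⟨max t 0 + 1, by positivity, fun y => ?_⟩
    have := ht (f (L y)) y (by rw [dist_comm]; exact hf (L y))
    exact this.trans_lt ((le_max_left t 0).trans_lt (lt_add_one _))

theorem dist_le_of_areClose {f : X → Y} {g : Y → X} (hf : IsCoarseMap f)
    (h : AreClose (f ∘ g) id) :
    ∀ r : ℝ, ∃ s : ℝ, ∀ x y, dist (g x) (g y) ≤ r → dist x y ≤ s := by
  intro r
  obtain ⟨R, -, hR⟩ := h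
  obtain ⟨s, -, hs⟩ := hf.uniformlyExpansive.exists_dist_le r
  refine ⟨s + 2 * R, fun x y hxy => ?_⟩
  have e1 := dist_triangle4 x (f (g x)) (f (g y)) y
  rw [dist_comm x (f (g x))] at e1
  have e2 : dist (f (g x)) x < R := hR x
  have e3 : dist (f (g y)) y < R := hR y
  linarith [hs _ _ hxy]

end CoarseEquivalences

/-! ### Properties of spaces coarsely equivalent to `ℤ`. -/

section EquivalentToIntegers

variable {X : Type u} [MetricSpace X]

theorem isCoarselyGeodesic_of_equivalent_int (h : CoarselyEquivalent X ℤ) :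
    IsCoarselyGeodesic X := by
  obtain ⟨f, hf, g, hg, hgf, hfg⟩ := h
  refine ⟨ULift.{u} ℝ, inferInstance, ?_, ?_⟩
  · rintro ⟨x⟩ ⟨y⟩
    have hd : dist (ULift.up.{u} x) (ULift.up.{u} y) = |x - y| := rfl
    rcases le_total x y with hxy | hxy
    · refine ⟨fun t => ⟨x + t⟩, by simp, ?_, fun s _ t _ => ?_⟩
      · rw [hd, abs_sub_comm, abs_of_nonneg (by linarith)]
        simp
      · change |x + s - (x + t)| = _
        congr 1
        ring
    · refine ⟨fun t => ⟨x - t⟩, by simp, ?_, fun s _ t _ => ?_⟩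
      · rw [hd, abs_of_nonneg (by linarith)]
        simp
      · change |x - s - (x - t)| = _
        rw [abs_sub_comm s t]
        congr 1
        ring
  · have hfl : ∀ t : ℝ, |t - ⌊t⌋| ≤ 1 := fun t => by
      rw [abs_le]
      constructor <;> linarith [Int.floor_le t, Int.lt_floor_add_one t]
    refine coarselyEquivalent_of_embedding (L := fun t : ULift.{u} ℝ => g ⌊t.down⌋) ?_ ?_ ?_
    · intro r
      obtain ⟨s, -, hs⟩ := hg.uniformlyExpansive.exists_dist_le (r + 2)
      refine ⟨s, fun x y hxy => hs _ _ ?_⟩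
      change |x.down - y.down| ≤ r at hxy
      rw [Int.dist_eq]
      have e1 := hfl x.down
      have e2 := hfl y.down
      rw [abs_le] at *
      constructor <;> linarith
    · intro r
      obtain ⟨s, hs⟩ := dist_le_of_areClose hf hfg r
      refine ⟨s + 2, fun x y hxy => ?_⟩
      have e0 := hs _ _ hxy
      change |x.down - y.down| ≤ s + 2
      rw [Int.dist_eq] at e0
      have e1 := hfl x.down
      have e2 := hfl y.down
      rw [abs_le] at *
      constructor <;> linarith
    · obtain ⟨R, -, hR⟩ := hgf
      refine ⟨R, fun x => ⟨⟨f x⟩, ?_⟩⟩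
      have : dist (g (f x)) x < R := hR x
      simp only [Int.floor_intCast]
      rw [dist_comm]
      exact this.le

theorem hasCoarseBoundedGeometry_of_equivalent_int (h : CoarselyEquivalent X ℤ) :
    HasCoarseBoundedGeometry X := by
  obtain ⟨f, hf, g, hg, hgf, hfg⟩ := h
  obtain ⟨R, hR0, hR⟩ := hgf
  refine ⟨range g, ⟨R, hR0, fun x => ⟨_, ⟨f x, rfl⟩, by rw [dist_comm]; exact hR x⟩⟩, ?_⟩
  choose s hs using dist_le_of_areClose hf hfg
  -- Points `g n`, `g m` in one ball of radius `t` are at distance at most `2 * t`, so `n` ranges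
  -- over an integer interval of radius `⌈s (2 * t)⌉₊` about `m`.
  refine ⟨fun t => (2 * ⌈s (2 * t)⌉₊ + 1 : ℕ), fun x t ht => ?_⟩
  rcases (range g ∩ closedBall x t).eq_empty_or_nonempty with he | ⟨_, ⟨m, rfl⟩, hm⟩
  · rw [he]
    simp
  have hsub : range g ∩ closedBall x t ⊆
      g '' (Icc (m - ⌈s (2 * t)⌉₊) (m + ⌈s (2 * t)⌉₊) : Set ℤ) := by
    rintro _ ⟨⟨n, rfl⟩, hn⟩
    refine ⟨n, ?_, rfl⟩
    have h1 : dist (g n) (g m) ≤ 2 * t := by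
      have := dist_triangle_right (g n) (g m) x
      rw [mem_closedBall] at hn hm
      linarith
    have h2 := (hs _ _ _ h1).trans (Nat.le_ceil _)
    rw [Int.dist_eq, abs_le] at h2
    have h3 : -(⌈s (2 * t)⌉₊ : ℤ) ≤ n - m := by exact_mod_cast h2.1
    have h4 : n - m ≤ (⌈s (2 * t)⌉₊ : ℤ) := by exact_mod_cast h2.2
    exact ⟨by linarith, by linarith⟩
  have hfin : (g '' (Icc (m - ⌈s (2 * t)⌉₊) (m + ⌈s (2 * t)⌉₊) : Set ℤ)).Finite :=
    (finite_Icc _ _).image g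
  refine ⟨hfin.subset hsub, ?_⟩
  have hcard : (range g ∩ closedBall x t).ncard ≤ 2 * ⌈s (2 * t)⌉₊ + 1 := by
    refine (ncard_le_ncard hsub hfin).trans ((ncard_image_le (finite_Icc _ _)).trans ?_)
    rw [ncard_eq_toFinset_card', toFinset_Icc, Int.card_Icc]
    omega
  exact Nat.cast_le.2 hcard

theorem isSum_of_equivalent_int [ProperSpace X] (h : CoarselyEquivalent X ℤ) :
    IsSumOfTwoIndecomposableContinuaHomeomorphicTo (HigsonCorona X) (HigsonCorona ℕ) := by
  refine ⟨HigsonCorona ℕ, HigsonCorona ℕ, inferInstance, inferInstance,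
    isIndecomposableContinuum_higsonCorona_nat, isIndecomposableContinuum_higsonCorona_nat,
    ⟨Homeomorph.refl _⟩, ⟨Homeomorph.refl _⟩, ?_⟩
  obtain ⟨f, hf, g, hg, hgf, hfg⟩ := h
  have hg' := dist_le_of_areClose hf hfg
  have hcoarse : ∀ φ : ℕ → ℤ, (∀ m n, dist (φ m) (φ n) = dist m n) → IsCoarseMap φ := fun φ hφ =>
    ⟨uniformlyExpansive_of_exists_dist_le fun r => ⟨r, fun x y hxy => (hφ x y).trans_le hxy⟩,
      metricallyProper_of_exists_dist_le fun r => ⟨r, fun x y hxy => (hφ x y).symm.trans_le hxy⟩⟩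
  have hpos : ∀ m n : ℕ, dist (m : ℤ) (n : ℤ) = dist m n := fun m n => by
    rw [Int.dist_eq, Nat.dist_eq]
    simp
  have hneg : ∀ m n : ℕ, dist (-m : ℤ) (-n : ℤ) = dist m n := fun m n => by
    rw [dist_neg_neg, hpos]
  have hp := hg.comp (hcoarse _ hpos)
  have hn := hg.comp (hcoarse _ hneg)
  obtain ⟨F, hF, hFlim⟩ := hp.exists_corona_map
  obtain ⟨G, hG, hGlim⟩ := hn.exists_corona_map
  have hinj : ∀ φ : ℕ → ℤ, (∀ m n, dist (φ m) (φ n) = dist m n) → ∀ r : ℝ, ∃ s : ℝ, ∀ x y,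
      dist ((g ∘ φ) x) ((g ∘ φ) y) ≤ r → dist x y ≤ s := fun φ hφ r => by
    obtain ⟨s, hs⟩ := hg' r
    exact ⟨s, fun x y hxy => (hφ x y).symm.trans_le (hs _ _ hxy)⟩
  -- The distance from `m` to `-n` is `m + n`, so closeness of the images bounds `m`.
  have hdiv : Diverge (range (g ∘ fun n : ℕ => (n : ℤ))) (range (g ∘ fun n : ℕ => (-n : ℤ))) := by
    intro r
    obtain ⟨s, hs⟩ := hg' r
    refine (hg.isBounded_image (isBounded_closedBall (x := (0 : ℤ)) (r := s))).subset ?_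
    rintro _ ⟨⟨m, rfl⟩, _, ⟨n, rfl⟩, hmn⟩
    refine ⟨m, ?_, rfl⟩
    have := hs _ _ hmn
    rw [mem_closedBall, Int.dist_eq] at *
    push_cast at this ⊢
    have h0 : (0 : ℝ) ≤ m := m.cast_nonneg
    have h1 : (0 : ℝ) ≤ n := n.cast_nonneg
    rw [abs_of_nonneg (by linarith)] at this ⊢
    linarith
  have hbij : Function.Bijective (Sum.elim F G) := by
    constructor
    · rintro (x | x) (y | y) hxy <;> obtain ⟨U, rfl⟩ := surjective_coronaLim x <;>
        obtain ⟨V, rfl⟩ := surjective_coronaLim y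
      · simp only [Sum.elim_inl, hFlim] at hxy
        rw [coronaLim_eq_of_map_eq hp (hinj _ hpos) hxy]
      · simp only [Sum.elim_inl, Sum.elim_inr, hFlim, hGlim] at hxy
        exact absurd hxy (coronaLim_ne_of_diverge range_mem_map range_mem_map hdiv)
      · simp only [Sum.elim_inl, Sum.elim_inr, hFlim, hGlim] at hxy
        exact absurd hxy (coronaLim_ne_of_diverge range_mem_map range_mem_map hdiv.symm)
      · simp only [Sum.elim_inr, hGlim] at hxy
        rw [coronaLim_eq_of_map_eq hn (hinj _ hneg) hxy]
    · intro z
      obtain ⟨U, rfl⟩ := surjective_coronaLim z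
      obtain ⟨R, -, hR⟩ := hgf
      have habs : Tendsto (fun n : ℤ => n.natAbs) (cobounded ℤ) (cobounded ℕ) := by
        refine IsCoarseMap.tendsto_cobounded ⟨?_, ?_⟩
        · refine uniformlyExpansive_of_exists_dist_le fun r => ⟨r, fun x y hxy => le_trans ?_ hxy⟩
          rw [Int.dist_eq, Nat.dist_eq, Nat.cast_natAbs, Nat.cast_natAbs, Int.cast_abs,
            Int.cast_abs]
          exact abs_abs_sub_abs_le_abs_sub _ _
        · intro B hB
          obtain ⟨s, hs⟩ := hB.subset_closedBall 0
          refine (isBounded_closedBall (x := (0 : ℤ)) (r := s)).subset fun n hn => ?_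
          have := hs hn
          rw [mem_closedBall, Nat.dist_eq, Nat.cast_natAbs] at this
          rw [mem_closedBall, Int.dist_eq]
          simpa using this
      let V : UltrafilterAtInfty ℕ :=
        ⟨(U.1.map f).map Int.natAbs, (habs.comp hf.tendsto_cobounded).mono_left U.2⟩
      have hclose : ∀ x, dist (g (f x)) x ≤ R := fun x => (hR x).le
      -- The ultrafilter decides the sign of `f`, hence which half-line it comes from. On the chosen
      -- set the push-forward through that half-line is `g ∘ f`, which is close to the identity.
      rcases U.1.mem_or_compl_mem {x | 0 ≤ f x} with hU | hU
      · refine ⟨Sum.inl (coronaLim V), ?_⟩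
        rw [Sum.elim_inl, hFlim]
        refine coronaLim_eq_of_close (U := U.1) (f := fun x => g ((f x).natAbs : ℤ)) (g := id)
          rfl (by simp) (r := R) ?_
        filter_upwards [hU] with x hx
        rw [Int.natAbs_of_nonneg hx]
        exact hclose x
      · refine ⟨Sum.inr (coronaLim V), ?_⟩
        rw [Sum.elim_inr, hGlim]
        refine coronaLim_eq_of_close (U := U.1) (f := fun x => g (-((f x).natAbs : ℤ))) (g := id)
          rfl (by simp) (r := R) ?_
        filter_upwards [hU] with x hx
        have hx' : f x < 0 := not_le.1 hx
        rw [Int.ofNat_natAbs_of_nonpos hx'.le, neg_neg]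
        exact hclose x
  have hcont : Continuous (Sum.elim F G) := hF.sumElim hG
  exact ⟨(hcont.homeoOfEquivCompactToT2 (f := Equiv.ofBijective _ hbij)).symm⟩

end EquivalentToIntegers

/-! ### Graphs modelling coarsely geodesic spaces, chain connected sets, coarse rays. -/

section CoarseGraph

variable {X : Type u}

/-- A connected graph, joining the points at distance at most `c`, whose path metric is coarsely
equivalent to the metric of `X`. -/
structure IsCoarseGraph [MetricSpace X] (G : SimpleGraph X) (c : ℝ) : Prop where
  pos : 0 < c
  connected : G.Connected
  adj_iff : ∀ x y, G.Adj x y ↔ x ≠ y ∧ dist x y ≤ c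
  exists_graph_dist_le : ∀ r : ℝ, ∃ n : ℕ, ∀ x y, dist x y ≤ r → G.dist x y ≤ n

theorem exists_walk_length_le_one [MetricSpace X] {G : SimpleGraph X} {c : ℝ}
    (h : ∀ x y, G.Adj x y ↔ x ≠ y ∧ dist x y ≤ c) {x y : X} (hxy : dist x y ≤ c) :
    ∃ w : G.Walk x y, w.length ≤ 1 := by
  by_cases he : x = y
  · subst he
    exact ⟨.nil, by simp⟩
  · exact ⟨.cons ((h x y).2 ⟨he, hxy⟩) .nil, by simp⟩

theorem IsCoarselyGeodesic.exists_isCoarseGraph [MetricSpace X] [Nonempty X]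
    (h : IsCoarselyGeodesic X) : ∃ (G : SimpleGraph X) (c : ℝ), IsCoarseGraph G c := by
  obtain ⟨M, _, hM, f, hf, g, hg, ⟨R, hR0, hR⟩, -⟩ := h
  obtain ⟨s, hs0, hs⟩ := hg.uniformlyExpansive.exists_dist_le 1
  -- The threshold `s + R` allows two kinds of edges: images under `g` of steps of length at most
  -- `1` in `M`, and the passage from `x` to `g (f x)`.
  let G : SimpleGraph X :=
    { Adj := fun x y => x ≠ y ∧ dist x y ≤ s + R
      symm := ⟨fun x y h => ⟨h.1.symm, by rw [dist_comm]; exact h.2⟩⟩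
      loopless := ⟨fun x h => h.1 rfl⟩ }
  have hadj : ∀ x y, G.Adj x y ↔ x ≠ y ∧ dist x y ≤ s + R := fun x y => Iff.rfl
  have hRx : ∀ x, dist (g (f x)) x < R := hR
  have key : ∀ x y, ∃ w : G.Walk x y, w.length ≤ ⌈dist (f x) (f y)⌉₊ + 2 := by
    intro x y
    obtain ⟨γ, hγ0, hγ1, hγ⟩ := hM (f x) (f y)
    set D := dist (f x) (f y) with hD
    have hD0 : 0 ≤ D := dist_nonneg
    -- The geodesic is sampled at integer times, truncated at its possibly non-integral end `D`.
    have hmem : ∀ i : ℕ, min (i : ℝ) D ∈ Icc 0 D := fun i =>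
      ⟨le_min i.cast_nonneg hD0, min_le_right _ _⟩
    have hwalk : ∀ i : ℕ, ∃ w : G.Walk (g (γ (min ((0 : ℕ) : ℝ) D))) (g (γ (min (i : ℝ) D))),
        w.length ≤ i := by
      intro i
      induction i with
      | zero => exact ⟨.nil, by simp⟩
      | succ i ih =>
        obtain ⟨w, hw⟩ := ih
        obtain ⟨w', hw'⟩ := exists_walk_length_le_one hadj
          (x := g (γ (min (i : ℝ) D))) (y := g (γ (min ((i + 1 : ℕ) : ℝ) D))) (by
            refine (hs _ _ ?_).trans (by linarith)
            rw [hγ _ (hmem i) _ (hmem (i + 1))]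
            refine (abs_min_sub_min_le_max _ _ _ _).trans ?_
            simp)
        exact ⟨w.append w', by rw [SimpleGraph.Walk.length_append]; omega⟩
    obtain ⟨w, hw⟩ : ∃ w : G.Walk (g (f x)) (g (f y)), w.length ≤ ⌈D⌉₊ := by
      have := hwalk ⌈D⌉₊
      rwa [min_eq_right (Nat.le_ceil D), hγ1, Nat.cast_zero, min_eq_left hD0, hγ0] at this
    obtain ⟨w₁, hw₁⟩ := exists_walk_length_le_one hadj (x := x) (y := g (f x))
      (by rw [dist_comm]; linarith [hRx x])
    obtain ⟨w₂, hw₂⟩ := exists_walk_length_le_one hadj (x := g (f y)) (y := y)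
      (by linarith [hRx y])
    refine ⟨(w₁.append w).append w₂, ?_⟩
    rw [SimpleGraph.Walk.length_append, SimpleGraph.Walk.length_append]
    omega
  refine ⟨G, s + R, by linarith, ⟨fun x y => (key x y).elim fun w _ => ⟨w⟩⟩, hadj, fun r => ?_⟩
  obtain ⟨t, -, ht⟩ := hf.uniformlyExpansive.exists_dist_le r
  refine ⟨⌈t⌉₊ + 2, fun x y hxy => ?_⟩
  obtain ⟨w, hw⟩ := key x y
  refine (G.dist_le w).trans (hw.trans ?_)
  gcongr
  exact ht x y hxy

section

variable [MetricSpace X] {G : SimpleGraph X} {c : ℝ}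

theorem IsCoarseGraph.graph_dist_le_one (hG : IsCoarseGraph G c) {x y : X} (h : dist x y ≤ c) :
    G.dist x y ≤ 1 := by
  obtain ⟨w, hw⟩ := exists_walk_length_le_one hG.adj_iff h
  exact (G.dist_le w).trans hw

theorem IsCoarseGraph.dist_le (hG : IsCoarseGraph G c) (x y : X) :
    dist x y ≤ c * G.dist x y := by
  have key : ∀ {x y : X} (w : G.Walk x y), dist x y ≤ c * w.length := by
    intro x y w
    induction w with
    | nil => simp
    | cons h w ih =>
      rw [SimpleGraph.Walk.length_cons]
      push_cast
      have := ((hG.adj_iff _ _).1 h).2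
      have := dist_triangle (α := X) _ _ _ |>.trans (add_le_add this ih)
      linarith
  obtain ⟨w, hw⟩ := hG.connected.exists_walk_length_eq_dist x y
  exact hw ▸ key w

theorem IsCoarseGraph.isBounded_of_graph_dist_le (hG : IsCoarseGraph G c) (o : X) {A : Set X}
    (N : ℕ) (h : ∀ x ∈ A, G.dist o x ≤ N) : IsBounded A := by
  refine (isBounded_closedBall (x := o) (r := c * N)).subset fun x hx => ?_
  rw [mem_closedBall, dist_comm]
  refine (hG.dist_le o x).trans (mul_le_mul_of_nonneg_left ?_ hG.pos.le)
  exact_mod_cast h x hx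

theorem IsCoarseGraph.exists_graph_dist_le_of_isBounded (hG : IsCoarseGraph G c) (o : X)
    {A : Set X} (h : IsBounded A) : ∃ N : ℕ, ∀ x ∈ A, G.dist o x ≤ N := by
  obtain ⟨R, hR⟩ := h.subset_closedBall o
  obtain ⟨N, hN⟩ := hG.exists_graph_dist_le R
  exact ⟨N, fun x hx => hN o x (by rw [dist_comm]; exact hR hx)⟩

/-- Distant neighbours lie in the same part of a diverging cover. -/
theorem IsCoarseGraph.exists_adj_mem (hG : IsCoarseGraph G c) (o : X) {A B : Set X}
    (h : Diverge A B) : ∃ N : ℕ, ∀ x ∈ A, ∀ y ∈ A ∪ B, N < G.dist o x → dist x y ≤ c → y ∈ A := by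
  obtain ⟨N, hN⟩ := hG.exists_graph_dist_le_of_isBounded o (h c)
  refine ⟨N, fun x hx y hy hlt hxy => hy.resolve_right fun hyB => ?_⟩
  exact absurd (hN x ⟨hx, y, hyB, hxy⟩) (not_le.2 hlt)

theorem IsCoarseGraph.exists_geodesic (hG : IsCoarseGraph G c) (x y : X) :
    ∃ γ : ℕ → X, γ 0 = x ∧ γ (G.dist x y) = y ∧ (∀ i, dist (γ i) (γ (i + 1)) ≤ c) ∧
      ∀ i, i ≤ G.dist x y → G.dist x (γ i) = i := by
  obtain ⟨w, hw⟩ := hG.connected.exists_walk_length_eq_dist x y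
  have hstep : ∀ i, dist (w.getVert i) (w.getVert (i + 1)) ≤ c := fun i => by
    rcases lt_or_ge i w.length with hi | hi
    · exact ((hG.adj_iff _ _).1 (w.adj_getVert_succ hi)).2
    · rw [w.getVert_of_length_le hi, w.getVert_of_length_le (by omega), dist_self]
      exact hG.pos.le
  have hsum : ∀ i j, G.dist (w.getVert i) (w.getVert (i + j)) ≤ j := fun i j => by
    induction j with
    | zero => simp
    | succ j ih =>
      have h1 := hG.connected.dist_triangle (u := w.getVert i) (v := w.getVert (i + j))
        (w := w.getVert (i + j + 1))
      have h2 := hG.graph_dist_le_one (hstep (i + j))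
      rw [← add_assoc]
      omega
  refine ⟨w.getVert, w.getVert_zero, by rw [← hw, w.getVert_length], hstep, fun i hi => ?_⟩
  have h1 := hsum 0 i
  have h2 := hsum i (w.length - i)
  rw [zero_add, w.getVert_zero] at h1
  rw [show i + (w.length - i) = w.length by omega, w.getVert_length] at h2
  have h3 := hG.connected.dist_triangle (u := x) (v := w.getVert i) (w := y)
  omega

end

/-- A set of vertices is chain connected if it cannot be split without separating neighbours. -/
def IsChainConnected (G : SimpleGraph X) (S : Set X) : Prop :=
  ∀ T : Set X, (∀ a ∈ S, ∀ b ∈ S, G.Adj a b → a ∈ T → b ∈ T) → (∃ a ∈ S, a ∈ T) → S ⊆ T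

theorem isChainConnected_singleton (G : SimpleGraph X) (x : X) : IsChainConnected G {x} := by
  rintro T - ⟨a, rfl, ha⟩ b rfl
  exact ha

theorem isChainConnected_iUnion {G : SimpleGraph X} {ι : Sort*} {S : ι → Set X} (x : X)
    (h : ∀ i, IsChainConnected G (S i)) (hx : ∀ i, x ∈ S i) : IsChainConnected G (⋃ i, S i) := by
  rintro T hT ⟨a, ha, haT⟩
  have hT' : ∀ i, ∀ a ∈ S i, ∀ b ∈ S i, G.Adj a b → a ∈ T → b ∈ T := fun i a ha b hb =>
    hT a (mem_iUnion_of_mem i ha) b (mem_iUnion_of_mem i hb)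
  obtain ⟨i, hi⟩ := mem_iUnion.1 ha
  have hxT : x ∈ T := h i T (hT' i) ⟨a, hi, haT⟩ (hx i)
  exact iUnion_subset fun j => h j T (hT' j) ⟨x, hx j, hxT⟩

theorem IsChainConnected.union {G : SimpleGraph X} {S S' : Set X} (x : X)
    (h : IsChainConnected G S) (h' : IsChainConnected G S') (hx : x ∈ S) (hx' : x ∈ S') :
    IsChainConnected G (S ∪ S') := by
  rw [union_eq_iUnion]
  exact isChainConnected_iUnion x (Bool.forall_bool.2 ⟨h', h⟩) (Bool.forall_bool.2 ⟨hx', hx⟩)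

theorem isChainConnected_support {G : SimpleGraph X} {x y : X} (w : G.Walk x y) :
    IsChainConnected G {z | z ∈ w.support} := by
  induction w with
  | nil =>
    intro T _ ⟨a, ha, haT⟩ b hb
    simp only [SimpleGraph.Walk.support_nil, List.mem_singleton, mem_ofPred_eq] at ha hb
    rwa [hb, ← ha]
  | @cons p q r hpq w ih =>
    intro T hT ⟨a, ha, haT⟩ b hb
    simp only [SimpleGraph.Walk.support_cons, List.mem_cons, mem_ofPred_eq] at hT ha hb
    have hq : q ∈ w.support := w.start_mem_support
    have hqT : q ∈ T := by
      rcases ha with rfl | ha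
      · exact hT a (Or.inl rfl) q (Or.inr hq) hpq haT
      · exact ih T (fun a ha b hb => hT a (Or.inr ha) b (Or.inr hb)) ⟨a, ha, haT⟩ hq
    rcases hb with rfl | hb
    · exact hT q (Or.inr hq) b (Or.inl rfl) hpq.symm hqT
    · exact ih T (fun a ha b hb => hT a (Or.inr ha) b (Or.inr hb)) ⟨q, hq, hqT⟩ hb

theorem graph_dist_le_of_mem_support {G : SimpleGraph X} {x y z : X} (w : G.Walk x y)
    (hz : z ∈ w.support) : G.dist x z ≤ w.length := by
  classical
  exact (G.dist_le (w.takeUntil z hz)).trans (w.length_takeUntil_le_length hz)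

theorem isChainConnected_graph_ball {G : SimpleGraph X} (hG : G.Connected) (x : X) (n : ℕ) :
    IsChainConnected G {y | G.dist x y ≤ n} := by
  choose w hw using fun y => hG.exists_walk_length_eq_dist x y
  have : {y | G.dist x y ≤ n} = ⋃ y : {y // G.dist x y ≤ n}, {z | z ∈ (w y.1).support} := by
    ext z
    simp only [mem_iUnion, mem_ofPred_eq]
    constructor
    · exact fun hz => ⟨⟨z, hz⟩, (w z).end_mem_support⟩
    · rintro ⟨⟨y, hy⟩, hz⟩
      exact (graph_dist_le_of_mem_support _ hz).trans ((hw y).trans_le hy)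
  rw [this]
  exact isChainConnected_iUnion x (fun y => isChainConnected_support _)
    fun y => (w y.1).start_mem_support

/-- A sequence starting at `o` along which the graph distance is the difference of the indices,
up to an error of `2`. -/
structure IsCoarseRay (G : SimpleGraph X) (o : X) (R : ℕ → X) : Prop where
  zero : R 0 = o
  dist_le : ∀ i j, G.dist (R i) (R (i + j)) ≤ j
  le_dist : ∀ i j, j ≤ G.dist (R i) (R (i + j)) + 2

theorem IsCoarseRay.dist_zero_le {G : SimpleGraph X} {o : X} {R : ℕ → X} (hR : IsCoarseRay G o R)
    (k : ℕ) : G.dist o (R k) ≤ k := by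
  have := hR.dist_le 0 k
  rwa [zero_add, hR.zero] at this

theorem IsCoarseRay.le_dist_zero {G : SimpleGraph X} {o : X} {R : ℕ → X} (hR : IsCoarseRay G o R)
    (k : ℕ) : k ≤ G.dist o (R k) + 2 := by
  have := hR.le_dist 0 k
  rwa [zero_add, hR.zero] at this

/-- Geodesics towards an ultrafilter at infinity converge to a coarse ray. -/
theorem IsCoarseGraph.exists_isCoarseRay [MetricSpace X] [ProperSpace X] {G : SimpleGraph X}
    {c : ℝ} (hG : IsCoarseGraph G c) (o : X) {P : Set X} (hP : ¬ IsBounded P)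
    (hdiv : Diverge P Pᶜ) :
    ∃ R : ℕ → X, IsCoarseRay G o R ∧ ∃ N : ℕ, ∀ k, N < k → R k ∈ P := by
  obtain ⟨U, hU⟩ := exists_ultrafilterAtInfty_mem hP
  choose γ hγ0 hγ1 hγstep hγdist using hG.exists_geodesic o
  have hfar : ∀ n : ℕ, ∀ᶠ x in (U.1 : Filter X), n ≤ G.dist o x := fun n => by
    have hb : IsBounded {x | G.dist o x ≤ n} := hG.isBounded_of_graph_dist_le o n fun x hx => hx
    filter_upwards [U.2 (isBounded_def.1 hb)] with x hx
    rw [mem_compl_iff, mem_ofPred_eq] at hx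
    omega
  -- The `k`-th vertices of the geodesics from `o` stay in a compact ball. Being at distance at most
  -- `c` is a closed condition, so steps of the geodesics pass to the limit.
  have hlim : ∀ k, ∃ z, Tendsto (fun x => γ x k) U.1 (𝓝 z) := fun k => by
    have hmem : (closedBall o (c * k) : Set X) ∈ U.1.map (fun x => γ x k) := by
      refine mem_map.2 ?_
      filter_upwards [hfar k] with x hx
      refine mem_preimage.2 (mem_closedBall.2 ?_)
      rw [dist_comm]
      simpa [hγdist x k hx] using hG.dist_le o (γ x k)
    obtain ⟨z, -, hz⟩ := (isCompact_closedBall o (c * k)).ultrafilter_le_nhds _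
      (le_principal_iff.2 hmem)
    exact ⟨z, hz⟩
  choose R hR using hlim
  have hstep : ∀ i, G.dist (R i) (R (i + 1)) ≤ 1 := fun i => hG.graph_dist_le_one
    (le_of_tendsto ((hR i).dist (hR (i + 1))) (Eventually.of_forall fun x => hγstep x i))
  have hnear : ∀ i, ∀ᶠ x in (U.1 : Filter X), dist (γ x i) (R i) ≤ c := fun i =>
    (hR i).eventually (closedBall_mem_nhds _ hG.pos)
  obtain ⟨N, hN⟩ := hG.exists_adj_mem o hdiv
  have hPU : P ∪ Pᶜ = univ := union_compl_self P
  refine ⟨R, ⟨?_, fun i j => ?_, fun i j => ?_⟩, N, fun k hk => ?_⟩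
  · refine tendsto_nhds_unique (hR 0) ?_
    simp only [hγ0]
    exact tendsto_const_nhds
  · induction j with
    | zero => simp
    | succ j ih =>
      have h1 := hG.connected.dist_triangle (u := R i) (v := R (i + j)) (w := R (i + j + 1))
      have h2 := hstep (i + j)
      rw [← add_assoc]
      omega
  -- Replacing `R i` and `R (i + j)` by the vertices of one long geodesic costs at most one edge at
  -- each end, whence the error `2`.
  · obtain ⟨x, h1, h2, h3⟩ := ((hnear i).and ((hnear (i + j)).and (hfar (i + j)))).exists
    have e1 := hG.graph_dist_le_one h1
    have e2 := hG.graph_dist_le_one h2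
    have e3 := hγdist x i (by omega)
    have e4 := hγdist x (i + j) h3
    have t1 := hG.connected.dist_triangle (u := o) (v := γ x i) (w := γ x (i + j))
    have t2 := hG.connected.dist_triangle (u := γ x i) (v := R i) (w := γ x (i + j))
    have t3 := hG.connected.dist_triangle (u := R i) (v := R (i + j)) (w := γ x (i + j))
    rw [G.dist_comm (u := R (i + j)) (v := γ x (i + j))] at t3
    omega
  · obtain ⟨x, h1, h2, h3⟩ := ((hnear k).and ((hfar k).and hU)).exists
    -- Followed backwards from its end in `P`, the geodesic cannot leave `P` outside the ball of
    -- radius `N`.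
    have hback : ∀ m, k + m ≤ G.dist o x → γ x (k + m) ∈ P → γ x k ∈ P := by
      intro m
      induction m with
      | zero => exact fun _ h => h
      | succ m ih =>
        intro hle hmem
        refine ih (by omega) (hN _ hmem _ (hPU ▸ mem_univ _) ?_ ?_)
        · rw [hγdist x _ hle]
          omega
        · rw [dist_comm]
          exact hγstep x (k + m)
    have hkP : γ x k ∈ P := hback (G.dist o x - k) (by omega) (by
      rw [show k + (G.dist o x - k) = G.dist o x by omega, hγ1]
      exact h3)
    exact hN _ hkP _ (hPU ▸ mem_univ _) (by rw [hγdist x k h2]; exact hk) h1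

end CoarseGraph

/-! ### Hairs on a coarse ray and the subcontinua they produce. -/

section Subcontinua

variable {X : Type u} [MetricSpace X] {G : SimpleGraph X} {c : ℝ}

theorem IsCoarseGraph.diverge_image (hG : IsCoarseGraph G c) {x : ℕ → X} {I : Set ℕ} {B : Set X}
    (h : ∀ m ∈ I, ∀ b ∈ B, m ≤ G.dist (x m) b) : Diverge (x '' I) B := by
  intro r
  obtain ⟨N, hN⟩ := hG.exists_graph_dist_le r
  refine ((finite_Iic N).image x).isBounded.subset ?_
  rintro _ ⟨⟨m, hm, rfl⟩, b, hb, hmb⟩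
  exact ⟨m, (h m hm b hb).trans (hN _ _ hmb), rfl⟩

theorem IsCoarseGraph.not_isBounded_image (hG : IsCoarseGraph G c) (o : X) {x : ℕ → X} {I : Set ℕ}
    (hI : ∀ N, ∃ m ∈ I, N < m) (hx : ∀ m, m ≤ G.dist o (x m)) : ¬ IsBounded (x '' I) := by
  intro hb
  obtain ⟨N, hN⟩ := hG.exists_graph_dist_le_of_isBounded o hb
  obtain ⟨m, hm, hNm⟩ := hI N
  exact absurd ((hx m).trans (hN _ ⟨m, hm, rfl⟩)) (not_le.2 hNm)

/-- Outside the ball of radius `N` edges cannot leave `A`, so the tail of the ray after `R k` stays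
in `A`. Every hair `S n` with `n > k` meets this tail and is chain connected far out, so it lies in
`A` as well. The condition `N + 2 < k` absorbs the error `2` of the ray. -/
theorem IsCoarseRay.isBounded_of_tail_mem {o : X} {R : ℕ → X} (hR : IsCoarseRay G o R)
    (hG : IsCoarseGraph G c) {S : ℕ → Set X} (hS : ∀ n, IsBounded (S n))
    (hSc : ∀ n, IsChainConnected G (S n)) (hSfar : ∀ n, ∀ z ∈ S n, n ≤ G.dist o z)
    (hSR : ∀ n, ∃ k, R k ∈ S n) {I : Set ℕ} {A B : Set X}
    (hAB : A ∪ B = range R ∪ ⋃ n ∈ I, S n) {N k : ℕ} (hkA : R k ∈ A) (hk : N + 2 < k)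
    (hA : ∀ x ∈ A, ∀ y ∈ A ∪ B, N < G.dist o x → dist x y ≤ c → y ∈ A)
    (hdiv : Diverge A B) : IsBounded B := by
  have htail : ∀ j, k ≤ j → R j ∈ A := by
    intro j hj
    induction j, hj using Nat.le_induction with
    | base => exact hkA
    | succ j hj ih =>
      have h1 := hR.le_dist_zero j
      have h2 := hR.dist_le j 1
      by_cases he : R j = R (j + 1)
      · exact he ▸ ih
      have hadj : G.Adj (R j) (R (j + 1)) := SimpleGraph.dist_eq_one_iff_adj.1
        (le_antisymm h2 (hG.connected.pos_dist_of_ne he))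
      exact hA _ ih _ (hAB ▸ Or.inl ⟨_, rfl⟩) (by omega) ((hG.adj_iff _ _).1 hadj).2
  have hSA : ∀ n ∈ I, k < n → S n ⊆ A := by
    intro n hn hkn
    obtain ⟨j, hj⟩ := hSR n
    have h1 := hSfar n _ hj
    have h2 := hR.dist_zero_le j
    refine hSc n A (fun a ha b hb hab haA => ?_) ⟨R j, hj, htail j (by omega)⟩
    have h3 := hSfar n a ha
    exact hA a haA b (hAB ▸ Or.inr (mem_biUnion hn hb)) (by omega) ((hG.adj_iff _ _).1 hab).2
  have hbdd : IsBounded (R '' Iic k ∪ ⋃ n ∈ Iic k, S n) :=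
    ((finite_Iic k).image R).isBounded.union
      ((isBounded_biUnion (finite_Iic k)).2 fun n _ => hS n)
  refine ((hdiv 0).union hbdd).subset fun y hy => ?_
  by_cases hyA : y ∈ A
  · exact Or.inl ⟨hyA, y, hy, by simp⟩
  right
  have : y ∈ range R ∪ ⋃ n ∈ I, S n := hAB ▸ Or.inr hy
  rcases this with ⟨j, rfl⟩ | hyS
  · left
    refine ⟨j, ?_, rfl⟩
    by_contra hj
    exact hyA (htail j (le_of_not_ge hj))
  · right
    obtain ⟨n, hn, hyn⟩ := mem_iUnion₂.1 hyS
    refine mem_biUnion (x := n) ?_ hyn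
    by_contra hj
    exact hyA (hSA n hn (lt_of_not_ge hj) hyn)

variable [ProperSpace X]

/-- A coarse ray with distant chain connected sets attached to it has a connected trace. -/
theorem IsCoarseRay.isPreconnected_trace {o : X} {R : ℕ → X} (hR : IsCoarseRay G o R)
    (hG : IsCoarseGraph G c) {S : ℕ → Set X} (hS : ∀ n, IsBounded (S n))
    (hSc : ∀ n, IsChainConnected G (S n)) (hSfar : ∀ n, ∀ z ∈ S n, n ≤ G.dist o z)
    (hSR : ∀ n, ∃ k, R k ∈ S n) (I : Set ℕ) :
    IsPreconnected (trace (range R ∪ ⋃ n ∈ I, S n)) := by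
  refine CoarseCorona.isPreconnected_trace fun A B hAB hdiv => ?_
  obtain ⟨N₁, hN₁⟩ := hG.exists_adj_mem o hdiv
  obtain ⟨N₂, hN₂⟩ := hG.exists_adj_mem o hdiv.symm
  have hA : ∀ x ∈ A, ∀ y ∈ A ∪ B, max N₁ N₂ < G.dist o x → dist x y ≤ c → y ∈ A :=
    fun x hx y hy hlt => hN₁ x hx y hy ((le_max_left _ _).trans_lt hlt)
  have hB : ∀ x ∈ B, ∀ y ∈ A ∪ B, max N₁ N₂ < G.dist o x → dist x y ≤ c → y ∈ B :=
    fun x hx y hy hlt => hN₂ x hx y (union_comm A B ▸ hy) ((le_max_right _ _).trans_lt hlt)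
  have hk : R (max N₁ N₂ + 3) ∈ A ∪ B := hAB ▸ Or.inl ⟨_, rfl⟩
  rcases hk with hk | hk
  · exact Or.inr (hR.isBounded_of_tail_mem hG hS hSc hSfar hSR hAB hk (by omega) hA hdiv)
  · exact Or.inl (hR.isBounded_of_tail_mem hG hS hSc hSfar hSR (union_comm A B ▸ hAB) hk (by omega)
      (union_comm A B ▸ hB) hdiv.symm)

/-- Distant points of a set with connected trace are chained to the ray far from the origin. -/
theorem IsCoarseRay.exists_isChainConnected {o : X} {R : ℕ → X} (hR : IsCoarseRay G o R)
    (hG : IsCoarseGraph G c) {P : Set X} (hPc : IsPreconnected (trace P)) {k₀ : ℕ}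
    (hRP : ∀ k, k₀ < k → R k ∈ P) (M : ℕ) :
    ∃ M' : ℕ, ∀ x ∈ P, M' < G.dist o x → ∃ S : Set X, IsBounded S ∧ IsChainConnected G S ∧
      x ∈ S ∧ (∀ z ∈ S, M < G.dist o z) ∧ ∃ k, R k ∈ S := by
  let E : Set X := {x | x ∈ P ∧ ∃ S : Set X, IsBounded S ∧ IsChainConnected G S ∧
      x ∈ S ∧ (∀ z ∈ S, M < G.dist o z) ∧ ∃ k, R k ∈ S}
  -- A point of `P` near `E` and far from `o` is joined to `E` by a short walk that avoids the ball
  -- of radius `M`, so it belongs to `E` itself.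
  have hdiv : Diverge (P \ E) E := by
    intro r
    obtain ⟨n, hn⟩ := hG.exists_graph_dist_le r
    refine hG.isBounded_of_graph_dist_le o (M + n) ?_
    rintro x ⟨⟨hxP, hxE⟩, y, ⟨hyP, S, hSb, hSc, hyS, hSM, hSR⟩, hxy⟩
    by_contra! hlt
    obtain ⟨w, hw⟩ := hG.connected.exists_walk_length_eq_dist x y
    have hwn : w.length ≤ n := hw.trans_le (hn x y hxy)
    refine hxE ⟨hxP, {z | z ∈ w.support} ∪ S, (w.support.finite_toSet.isBounded).union hSb,
      (isChainConnected_support w).union y hSc w.end_mem_support hyS, Or.inl w.start_mem_support,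
      ?_, hSR.imp fun k hk => Or.inr hk⟩
    rintro z (hz | hz)
    · have h1 := graph_dist_le_of_mem_support w hz
      have h2 := hG.connected.dist_triangle (u := o) (v := z) (w := x)
      rw [G.dist_comm (u := z)] at h2
      omega
    · exact hSM z hz
  have hEb : ¬ IsBounded E := by
    refine fun hb => hG.not_isBounded_image o (x := fun m => R (m + 2)) (I := {m | k₀ + M < m})
      (fun N => ⟨k₀ + M + N + 1, by simp [add_assoc], by omega⟩) (fun m => ?_) (hb.subset ?_)
    · have := hR.le_dist_zero (m + 2)
      omega
    · rintro _ ⟨m, hm, rfl⟩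
      have hm' : k₀ + M < m := hm
      refine ⟨hRP _ (by omega), {R (m + 2)}, isBounded_singleton, isChainConnected_singleton _ _,
        rfl, ?_, m + 2, rfl⟩
      rintro z rfl
      have := hR.le_dist_zero (m + 2)
      omega
  have hF : IsBounded (P \ E) := by
    by_contra hFb
    have hcov : trace P ⊆ trace (P \ E) ∪ trace E := by
      rw [← trace_union]
      exact trace_mono fun x hx => by
        by_cases hxE : x ∈ E
        · exact Or.inr hxE
        · exact Or.inl ⟨hx, hxE⟩
    obtain ⟨p, hp⟩ := trace_nonempty hFb
    obtain ⟨q, hq⟩ := trace_nonempty hEb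
    obtain ⟨z, -, hz, hz'⟩ := isPreconnected_closed_iff.1 hPc _ _ (isClosed_trace _)
      (isClosed_trace _) hcov ⟨p, trace_mono sdiff_subset hp, hp⟩
      ⟨q, trace_mono (fun x hx => hx.1) hq, hq⟩
    exact disjoint_left.1 hdiv.disjoint_trace hz hz'
  obtain ⟨M', hM'⟩ := hG.exists_graph_dist_le_of_isBounded o hF
  refine ⟨M', fun x hx hlt => ?_⟩
  by_contra hS
  exact absurd (hM' x ⟨hx, fun hxE => hS hxE.2⟩) (not_le.2 hlt)

/-- If `P` is far from the ray, then there are points `x n` of `P` and distant chain connected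
sets `S n`, containing the balls around `x n` and attached to the ray, such that `x m` is far from
the ray and from `S n` for `m ≠ n`. -/
theorem IsCoarseRay.exists_hairs {o : X} {R : ℕ → X} (hR : IsCoarseRay G o R)
    (hG : IsCoarseGraph G c) {P : Set X} (hPc : IsPreconnected (trace P)) {k₀ : ℕ}
    (hRP : ∀ k, k₀ < k → R k ∈ P) (hfar : ∀ s : ℝ, ∃ x ∈ P, ∀ k, s < dist x (R k)) (N₀ : ℕ) :
    ∃ (x : ℕ → X) (S : ℕ → Set X), (∀ n, x n ∈ P) ∧ (∀ n k, n ≤ G.dist (x n) (R k)) ∧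
      (∀ n, IsBounded (S n)) ∧ (∀ n, IsChainConnected G (S n)) ∧ (∀ n, ∃ k, R k ∈ S n) ∧
      (∀ n, ∀ z ∈ S n, N₀ + n < G.dist o z) ∧ (∀ n y, G.dist (x n) y ≤ n → y ∈ S n) ∧
      ∀ m n, m ≠ n → ∀ z ∈ S n, m ≤ G.dist (x m) z := by
  -- At scale `M`, the point `x` is so far out that its ball of radius `M` also avoids the ball of
  -- radius `M` about `o`. The next scale `M'` exceeds the extent of `S` by at least `M`, which
  -- keeps hairs of different scales apart.
  have hstep : ∀ M : ℕ, ∃ (x : X) (S : Set X) (M' : ℕ), x ∈ P ∧ (∀ k, 4 * M < G.dist x (R k)) ∧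
      IsBounded S ∧ IsChainConnected G S ∧ (∃ k, R k ∈ S) ∧ (∀ z ∈ S, M < G.dist o z) ∧
      (∀ y, G.dist x y ≤ M → y ∈ S) ∧ M < M' ∧ ∀ z ∈ S, G.dist o z + M ≤ M' := by
    intro M
    obtain ⟨L, hL⟩ := hR.exists_isChainConnected hG hPc hRP M
    obtain ⟨x, hxP, hx⟩ := hfar (c * (L + 4 * M : ℕ))
    have hx' : ∀ k, L + 4 * M < G.dist x (R k) := fun k => by
      have h := (hx k).trans_le (hG.dist_le x (R k))
      have := lt_of_mul_lt_mul_left h hG.pos.le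
      exact_mod_cast this
    have hox : L + 4 * M < G.dist o x := by
      have := hx' 0
      rwa [hR.zero, G.dist_comm] at this
    obtain ⟨S, hSb, hSc, hxS, hSM, k, hk⟩ := hL x hxP (by omega)
    have hbb : IsBounded {y | G.dist x y ≤ M} := hG.isBounded_of_graph_dist_le x M fun y hy => hy
    obtain ⟨K, hK⟩ := hG.exists_graph_dist_le_of_isBounded o (hSb.union hbb)
    refine ⟨x, S ∪ {y | G.dist x y ≤ M}, K + M + 1, hxP, fun k => by have := hx' k; omega,
      hSb.union hbb, hSc.union x (isChainConnected_graph_ball hG.connected x M) hxS (by simp),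
      ⟨k, Or.inl hk⟩, ?_, fun y hy => Or.inr hy, by omega, fun z hz => by have := hK z hz; omega⟩
    rintro z (hz | hz)
    · exact hSM z hz
    · have h1 : G.dist x z ≤ M := hz
      have h2 := hG.connected.dist_triangle (u := o) (v := z) (w := x)
      rw [G.dist_comm (u := z)] at h2
      by_contra hM
      have h3 := hx' 0
      rw [hR.zero, G.dist_comm] at h3
      rcases Nat.eq_zero_or_pos M with h0 | h0 <;> omega
  choose x S next hxP hxR hSb hSc hSR hSfar hSball hnext hSnear using hstep
  let M : ℕ → ℕ := fun n => n.rec N₀ fun _ m => next m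
  have hM : ∀ n, M (n + 1) = next (M n) := fun _ => rfl
  have hmono : StrictMono M := strictMono_nat_of_lt_succ fun n => hnext (M n)
  have hMn : ∀ n, N₀ + n ≤ M n := fun n => by
    induction n with
    | zero => exact le_rfl
    | succ n ih =>
      have := hmono (Nat.lt_succ_self n)
      simp only [Nat.succ_eq_add_one] at this
      omega
  refine ⟨fun n => x (M n), fun n => S (M n), fun n => hxP _, fun n k => ?_, fun n => hSb _,
    fun n => hSc _, fun n => hSR _, fun n z hz => ?_, fun n y hy => hSball _ _ ?_, ?_⟩
  · beta_reduce
    have h1 := hxR (M n) k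
    have h2 := hMn n
    omega
  · exact (hMn n).trans_lt (hSfar _ z hz)
  · beta_reduce at hy
    have h2 := hMn n
    omega
  · intro m n hmn z hz
    beta_reduce
    have hm := hMn m
    have ho : 4 * M m < G.dist o (x (M m)) := by
      have := hxR (M m) 0
      rwa [hR.zero, G.dist_comm] at this
    rcases hmn.lt_or_gt with hlt | hlt
    · have h1 : M (m + 1) ≤ M n := hmono.monotone hlt
      have h2 := hSfar _ z hz
      have h3 := hSnear (M m) (x (M m)) (hSball _ _ (by simp))
      rw [← hM] at h3
      have h4 := hG.connected.dist_triangle (u := o) (v := x (M m)) (w := z)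
      omega
    · have h1 : M (n + 1) ≤ M m := hmono.monotone hlt
      have h3 := hSnear (M n) z hz
      rw [← hM] at h3
      have h4 := hG.connected.dist_triangle (u := o) (v := z) (w := x (M m))
      rw [G.dist_comm (u := z)] at h4
      omega

/-- A part of `X` whose trace is an indecomposable continuum stays near a coarse ray. -/
theorem IsCoarseRay.exists_dist_le {o : X} {R : ℕ → X} (hR : IsCoarseRay G o R)
    (hG : IsCoarseGraph G c) {P : Set X} (hdiv : Diverge P Pᶜ) (hPc : IsPreconnected (trace P))
    {k₀ : ℕ} (hRP : ∀ k, k₀ < k → R k ∈ P)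
    (hind : ∀ C ⊆ trace P, IsClosed C → IsPreconnected C → (interior C).Nonempty → C = trace P) :
    ∃ s : ℝ, ∀ x ∈ P, ∃ k, dist x (R k) ≤ s := by
  by_contra! hfar
  obtain ⟨N, hN⟩ := hG.exists_adj_mem o hdiv
  obtain ⟨x, S, hxP, hxR, hSb, hSc, hSR, hSfar, hSball, hxS⟩ := hR.exists_hairs hG hPc hRP hfar N
  have hxo : ∀ m, m ≤ G.dist o (x m) := fun m => by
    have := hxR m 0
    rwa [hR.zero, G.dist_comm] at this
  have hSP : ∀ n, S n ⊆ P := fun n =>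
    hSc n P (fun a ha b hb hab haP => hN a haP b (union_compl_self P ▸ mem_univ b)
      (by have := hSfar n a ha; omega) ((hG.adj_iff _ _).1 hab).2)
      ⟨x n, hSball n _ (by simp), hxP n⟩
  set A : Set X := range R ∪ ⋃ n ∈ {n | Even n}, S n with hA
  have hAP : trace A ⊆ trace P := by
    refine trace_subset_of_isBounded_diff (((finite_Iic k₀).image R).isBounded.subset ?_)
    rintro y ⟨⟨k, rfl⟩ | hy, hyP⟩
    · refine ⟨k, ?_, rfl⟩
      by_contra hk
      exact hyP (hRP k (lt_of_not_ge hk))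
    · obtain ⟨n, -, hn⟩ := mem_iUnion₂.1 hy
      exact absurd (hSP n hn) hyP
  have hAc : IsPreconnected (trace A) :=
    hR.isPreconnected_trace hG hSb hSc (fun n z hz => by have := hSfar n z hz; omega) hSR _
  have heven : (interior (trace A)).Nonempty := by
    -- The even hairs contain balls of growing radius about the even centres. Limits of these
    -- centres thus avoid the closed trace of `Aᶜ` and are interior to the trace of `A`.
    have hdivZ : Diverge (x '' {n | Even n}) Aᶜ := hG.diverge_image fun m hm b hb => by
      by_contra! hlt
      exact hb (Or.inr (mem_biUnion (x := m) hm (hSball m b hlt.le)))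
    obtain ⟨p, hp⟩ := trace_nonempty (hG.not_isBounded_image o (I := {n | Even n})
      (fun N => ⟨2 * (N + 1), by simp, by omega⟩) hxo)
    refine ⟨p, mem_interior.2 ⟨(trace Aᶜ)ᶜ, fun q hq => ?_, (isClosed_trace _).isOpen_compl,
      disjoint_left.1 hdivZ.disjoint_trace hp⟩⟩
    have : q ∈ trace A ∪ trace Aᶜ := trace_union_compl A ▸ mem_univ q
    exact this.resolve_right hq
  have hdivY : Diverge (x '' {n | ¬ Even n}) A := hG.diverge_image fun m hm b hb => by
    rcases hb with ⟨k, rfl⟩ | hb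
    · exact hxR m k
    · obtain ⟨n, hn, hbn⟩ := mem_iUnion₂.1 hb
      exact hxS m n (fun h => hm (h ▸ hn)) b hbn
  obtain ⟨p, hp⟩ := trace_nonempty (hG.not_isBounded_image o (I := {n | ¬ Even n})
    (fun N => ⟨2 * N + 1, by simp, by omega⟩) hxo)
  have hpP : p ∈ trace P := trace_mono (by rintro _ ⟨n, -, rfl⟩; exact hxP n) hp
  rw [← hind _ hAP (isClosed_trace A) hAc heven] at hpP
  exact disjoint_left.1 hdivY.disjoint_trace hp hpP

end Subcontinua

/-! ### Two diverging coarse rays form a coarse line. -/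

section CoarseLines

variable {X : Type u} {G : SimpleGraph X} {c : ℝ}

theorem IsCoarseRay.abs_sub_le {o : X} {R : ℕ → X} (hR : IsCoarseRay G o R) (i j : ℕ) :
    |(i : ℝ) - j| ≤ G.dist (R i) (R j) + 2 := by
  wlog h : i ≤ j generalizing i j
  · rw [G.dist_comm, abs_sub_comm]
    exact this j i (le_of_not_ge h)
  obtain ⟨d, rfl⟩ := Nat.exists_eq_add_of_le h
  push_cast
  rw [sub_add_cancel_left, abs_neg, Nat.abs_cast]
  exact_mod_cast hR.le_dist i d

variable [MetricSpace X]

/-- Two coarse rays in diverging parts of the space are far from each other. -/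
theorem IsCoarseRay.exists_index_le (hG : IsCoarseGraph G c) {o : X} {R R' : ℕ → X}
    (hR : IsCoarseRay G o R) (hR' : IsCoarseRay G o R') {P : Set X} (hdiv : Diverge P Pᶜ) {N N' : ℕ}
    (hRP : ∀ k, N < k → R k ∈ P) (hRP' : ∀ k, N' < k → R' k ∈ Pᶜ) (r : ℝ) :
    ∃ Q : ℕ, ∀ i j, dist (R i) (R' j) ≤ r → i + j ≤ Q := by
  obtain ⟨n, hn⟩ := hG.exists_graph_dist_le r
  obtain ⟨b, hb⟩ := hG.exists_graph_dist_le_of_isBounded o (hdiv r)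
  -- Indices agree with graph distances from `o` up to `2`, and those of `R i` and `R' j` differ by
  -- at most `n`. So it suffices to bound one index: by `N` or `N'` before a ray enters its part,
  -- and through the divergence bound `b` afterwards.
  refine ⟨2 * (N + N' + b) + n + 10, fun i j hij => ?_⟩
  have h1 := hn _ _ hij
  have h2 := hR.dist_zero_le i
  have h3 := hR.le_dist_zero i
  have h4 := hR'.dist_zero_le j
  have h5 := hR'.le_dist_zero j
  have h6 := hG.connected.dist_triangle (u := o) (v := R i) (w := R' j)
  have h7 := hG.connected.dist_triangle (u := o) (v := R' j) (w := R i)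
  rw [G.dist_comm (u := R' j)] at h7
  rcases le_or_gt i N with hi | hi
  · omega
  rcases le_or_gt j N' with hj | hj
  · omega
  have := hb (R i) ⟨hRP i hi, R' j, hRP' j hj, hij⟩
  omega

theorem IsCoarseRay.metric_dist_le (hG : IsCoarseGraph G c) {o : X} {R : ℕ → X}
    (hR : IsCoarseRay G o R) (i j : ℕ) : dist (R i) (R j) ≤ c * |(i : ℝ) - j| := by
  wlog h : i ≤ j generalizing i j
  · rw [dist_comm, abs_sub_comm]
    exact this j i (le_of_not_ge h)
  obtain ⟨d, rfl⟩ := Nat.exists_eq_add_of_le h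
  refine (hG.dist_le _ _).trans (mul_le_mul_of_nonneg_left ?_ hG.pos.le)
  push_cast
  rw [sub_add_cancel_left, abs_neg, Nat.abs_cast]
  exact_mod_cast hR.dist_le i d

/-- A space covered by neighbourhoods of two diverging coarse rays is coarsely a line. -/
theorem coarselyEquivalent_int_of_rays (hG : IsCoarseGraph G c) {o : X} {R R' : ℕ → X}
    (hR : IsCoarseRay G o R) (hR' : IsCoarseRay G o R')
    (hRR' : ∀ r : ℝ, ∃ Q : ℕ, ∀ i j, dist (R i) (R' j) ≤ r → i + j ≤ Q) {s : ℝ}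
    (hs : ∀ x, (∃ k, dist x (R k) ≤ s) ∨ ∃ k, dist x (R' k) ≤ s) : CoarselyEquivalent X ℤ := by
  let L : ℤ → X := fun n => if 0 ≤ n then R n.natAbs else R' n.natAbs
  have hLR : ∀ i : ℕ, L i = R i := fun i => by simp [L]
  have hLR' : ∀ i : ℕ, L (-i) = R' i := fun i => by
    rcases Nat.eq_zero_or_pos i with rfl | hi
    · simp [L, hR.zero, hR'.zero]
    · simp [L, show i ≠ 0 by omega]
  have hcases : ∀ p : ℤ → ℤ → Prop, (∀ i j : ℕ, p i j) → (∀ i j : ℕ, p i (-j)) →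
      (∀ i j : ℕ, p (-i) j) → (∀ i j : ℕ, p (-i) (-j)) → ∀ m n, p m n := by
    intro p h1 h2 h3 h4 m n
    obtain ⟨i, rfl | rfl⟩ := m.eq_nat_or_neg <;> obtain ⟨j, rfl | rfl⟩ := n.eq_nat_or_neg
    exacts [h1 i j, h2 i j, h3 i j, h4 i j]
  have habs : ∀ i j : ℕ, |(i : ℝ) + j| = i + j := fun i j => abs_of_nonneg (by positivity)
  have hlip : ∀ m n, dist (L m) (L n) ≤ c * dist m n := by
    refine hcases _ ?_ ?_ ?_ ?_ <;> intro i j <;> simp only [hLR, hLR', Int.dist_eq] <;> push_cast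
    · exact hR.metric_dist_le hG i j
    · have h1 := hR.metric_dist_le hG i 0
      have h2 := hR'.metric_dist_le hG 0 j
      have h3 := dist_triangle (R i) o (R' j)
      rw [hR.zero] at h1
      rw [hR'.zero] at h2
      simp only [Nat.cast_zero, sub_zero, zero_sub, abs_neg, Nat.abs_cast] at h1 h2
      rw [sub_neg_eq_add, habs]
      linarith
    · have h1 := hR'.metric_dist_le hG i 0
      have h2 := hR.metric_dist_le hG 0 j
      have h3 := dist_triangle (R' i) o (R j)
      rw [hR'.zero] at h1
      rw [hR.zero] at h2
      simp only [Nat.cast_zero, sub_zero, zero_sub, abs_neg, Nat.abs_cast] at h1 h2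
      rw [← neg_add', abs_neg, habs]
      linarith
    · rw [neg_sub_neg, abs_sub_comm]
      exact hR'.metric_dist_le hG i j
  refine coarselyEquivalent_of_embedding (L := L) (fun r => ⟨c * r, fun m n hmn =>
    (hlip m n).trans (mul_le_mul_of_nonneg_left hmn hG.pos.le)⟩) (fun r => ?_) ⟨s, fun x => ?_⟩
  · obtain ⟨N, hN⟩ := hG.exists_graph_dist_le r
    obtain ⟨Q, hQ⟩ := hRR' r
    refine ⟨max (N + 2) Q, ?_⟩
    have hN' : ∀ x y : X, dist x y ≤ r → (G.dist x y : ℝ) ≤ N := fun x y hxy => by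
      exact_mod_cast hN x y hxy
    have hQ' : ∀ i j, dist (R i) (R' j) ≤ r → (i : ℝ) + j ≤ Q := fun i j hij => by
      exact_mod_cast hQ i j hij
    refine hcases _ ?_ ?_ ?_ ?_ <;> intro i j hij <;>
      simp only [hLR, hLR', Int.dist_eq] at hij ⊢ <;> push_cast
    · exact le_max_of_le_left ((hR.abs_sub_le i j).trans (by linarith [hN' _ _ hij]))
    · rw [sub_neg_eq_add, habs]
      exact le_max_of_le_right (hQ' _ _ hij)
    · rw [← neg_add', abs_neg, habs, add_comm]
      rw [dist_comm] at hij
      exact le_max_of_le_right (hQ' _ _ hij)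
    · rw [neg_sub_neg, abs_sub_comm]
      exact le_max_of_le_left ((hR'.abs_sub_le i j).trans (by linarith [hN' _ _ hij]))
  · rcases hs x with ⟨k, hk⟩ | ⟨k, hk⟩
    · exact ⟨k, by rwa [hLR]⟩
    · exact ⟨-k, by rwa [hLR']⟩

end CoarseLines

/-! ### From a decomposition of the corona to a coarse line. -/

section TwoComponents

variable {X : Type u} [MetricSpace X] [ProperSpace X]

/-- If the trace of `P` is an embedded indecomposable continuum, open in the corona, then it
satisfies the hypotheses of `IsCoarseRay.exists_dist_le`. -/
theorem trace_of_indecomposable_embedding {K : Type v} [TopologicalSpace K]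
    (hK : IsIndecomposableContinuum K) {j : K → HigsonCorona X} (hj : IsOpenEmbedding j)
    {P : Set X} (hP : range j = trace P) :
    ¬ IsBounded P ∧ IsPreconnected (trace P) ∧
      ∀ C ⊆ trace P, IsClosed C → IsPreconnected C → (interior C).Nonempty → C = trace P := by
  have := hK.1.1
  have := hK.1.2.2.1
  refine ⟨fun hb => ?_, hP ▸ isPreconnected_range hj.continuous, fun C hCP hC hCc hCi => ?_⟩
  · have := range_nonempty j
    rw [hP, trace_eq_empty hb] at this
    exact not_nonempty_empty this
  · rw [← hP] at hCP
    have huniv : j ⁻¹' C = univ := by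
      refine hK.eq_univ (hC.preimage hj.continuous)
        (hCc.preimage_of_isOpenMap hj.injective hj.isOpenMap hCP) ?_
      obtain ⟨p, hp⟩ := hCi
      obtain ⟨q, rfl⟩ := hCP (interior_subset hp)
      exact ⟨q, preimage_interior_subset_interior_preimage hj.continuous hp⟩
    rw [← hP]
    refine hCP.antisymm ?_
    rintro _ ⟨q, rfl⟩
    exact (huniv ▸ mem_univ q : q ∈ j ⁻¹' C)

theorem coarselyEquivalent_int_of_isSum [Nonempty X] (hgeo : IsCoarselyGeodesic X) {S : Type v}
    [TopologicalSpace S]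
    (h : IsSumOfTwoIndecomposableContinuaHomeomorphicTo (HigsonCorona X) S) :
    CoarselyEquivalent X ℤ := by
  obtain ⟨K₁, K₂, _, _, hK₁, hK₂, -, -, ⟨φ⟩⟩ := h
  obtain ⟨G, c, hG⟩ := hgeo.exists_isCoarseGraph
  have o : X := Classical.arbitrary X
  have hj₁ : IsOpenEmbedding (φ.symm ∘ Sum.inl) := φ.symm.isOpenEmbedding.comp .inl
  have hj₂ : IsOpenEmbedding (φ.symm ∘ Sum.inr) := φ.symm.isOpenEmbedding.comp .inr
  have hcompl : (range (φ.symm ∘ Sum.inl))ᶜ = range (φ.symm ∘ Sum.inr) := by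
    rw [range_comp, range_comp, ← image_compl_eq φ.symm.bijective, compl_range_inl]
  have hclosed : IsClosed (range (φ.symm ∘ Sum.inl)) := by
    rw [← isOpen_compl_iff, hcompl]
    exact hj₂.isOpen_range
  -- The first summand is clopen, so it is squeezed to be exactly the trace of a set `P`, with the
  -- trace of `Pᶜ` as its complement.
  obtain ⟨P, hP1, hP2⟩ := exists_trace_between hclosed hj₁.isOpen_range Subset.rfl
  have hP : range (φ.symm ∘ Sum.inl) = trace P := by
    refine Subset.antisymm (fun p hp => ?_) hP2
    have : p ∈ trace P ∪ trace Pᶜ := trace_union_compl P ▸ mem_univ p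
    exact this.resolve_right (disjoint_left.1 hP1 hp)
  have hdiv : Diverge P Pᶜ := diverge_iff_disjoint_trace.2 (hP ▸ hP1)
  have hPc : range (φ.symm ∘ Sum.inr) = trace Pᶜ := by
    rw [← hcompl]
    refine Subset.antisymm (fun p hp => ?_) fun p hp hp' => disjoint_left.1 hP1 hp' hp
    have : p ∈ trace P ∪ trace Pᶜ := trace_union_compl P ▸ mem_univ p
    exact this.resolve_left fun h => hp (hP ▸ h)
  obtain ⟨hb₁, hc₁, hind₁⟩ := trace_of_indecomposable_embedding hK₁ hj₁ hP
  obtain ⟨hb₂, hc₂, hind₂⟩ := trace_of_indecomposable_embedding hK₂ hj₂ hPc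
  have hdiv' : Diverge Pᶜ Pᶜᶜ := by
    rw [compl_compl]
    exact hdiv.symm
  obtain ⟨R, hR, N, hRP⟩ := hG.exists_isCoarseRay o hb₁ hdiv
  obtain ⟨R', hR', N', hRP'⟩ := hG.exists_isCoarseRay o hb₂ hdiv'
  obtain ⟨s, hs⟩ := hR.exists_dist_le hG hdiv hc₁ hRP hind₁
  obtain ⟨s', hs'⟩ := hR'.exists_dist_le hG hdiv' hc₂ hRP' hind₂
  refine coarselyEquivalent_int_of_rays hG hR hR' (s := max s s')
    (fun r => hR.exists_index_le hG hR' hdiv hRP hRP' r) fun x => ?_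
  by_cases hx : x ∈ P
  · exact Or.inl ((hs x hx).imp fun k hk => hk.trans (le_max_left _ _))
  · exact Or.inr ((hs' x hx).imp fun k hk => hk.trans (le_max_right _ _))

end TwoComponents

end CoarseCorona

theorem theorem3p12 (X : Type u) [MetricSpace X] [ProperSpace X] [NoncompactSpace X] :
    CoarseCorona.CoarselyEquivalent X ℤ ↔
      (CoarseCorona.IsCoarselyGeodesic X ∧ CoarseCorona.HasCoarseBoundedGeometry X) ∧
      CoarseCorona.IsSumOfTwoIndecomposableContinuaHomeomorphicTo
        (CoarseCorona.HigsonCorona X) (CoarseCorona.HigsonCorona ℕ) := by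
  constructor
  · exact fun h => ⟨⟨CoarseCorona.isCoarselyGeodesic_of_equivalent_int h,
      CoarseCorona.hasCoarseBoundedGeometry_of_equivalent_int h⟩,
      CoarseCorona.isSum_of_equivalent_int h⟩
  · rintro ⟨⟨hgeo, -⟩, hsum⟩
    have : Nonempty X := by
      by_contra hX
      rw [not_nonempty_iff] at hX
      exact NoncompactSpace.noncompact_univ (X := X) (by simp)
    exact CoarseCorona.coarselyEquivalent_int_of_isSum hgeo hsum
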